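/- For $n\in\mathbb N$ let $\mathbf p=\mathbf p(n)=(p_{11},p_{10},p_{01},p_{00})$ be a probability vector. Let $(G_a,G_b)\sim ER(n,\mathbf p)$ be the pair of correlated Erdős–Rényi graphs on $[n]=\{0,\dots,n-1\}$: the edge-indicator pairs $(G_a(e),G_b(e))\in\{0,1\}^2$, $e\in\binom{[n]}{2}$, are i.i.d. and equal $(i,j)$ with probability $p_{ij}$. Let $\Pi$ be a uniformly random permutation of $[n]$, independent of $(G_a,G_b)$, and let $G_c$ be the graph on $[n]$ with $G_c(\{\Pi(i),\Pi(j)\})=G_a(\{i,j\})$ for all $i\ne j$. An estimator is a function $\hat\pi_n$ that maps a pair of graphs on $[n]$ to a permutation of $[n]$; it is correct if $\hat\pi_n(G_c,G_b)=\Pi$. All asymptotics are as $n\to\infty$. **Achievability.** Suppose that $$p_{11}\ge\frac{\log n+\omega(1)}{n},\qquad p_{11}\le O\Big(\frac1{\log n}\Big),\qquad p_{01}+p_{10}\le O\Big(\frac1{\log n}\Big),\qquad \frac{p_{01}p_{10}}{p_{11}p_{00}}\le O\Big(\frac1{(\log n)^3}\Big).$$ Then there is a sequence of estimators $\hat\pi_n$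 that is correct with probability $1-o(1)$. **Converse.** Suppose that $$p_{11}\le\frac{\log n-\omega(1)}{n}\qquad\text{and}\qquad p_{01}p_{10}<p_{11}p_{00}$$ for all sufficiently large $n$. Then every sequence of estimators $\hat\pi_n$ is correct with probability $o(1)$. Here $\omega(1)$ stands for some sequence that tends to $+\infty$. -/

import Mathlib

open Filter Topology Asymptotics

namespace GraphAlignment

/-- The parameter `(p₁₁, p₁₀, p₀₁, p₀₀)` of the correlated Erdős–Rényi model:
a probability vector on `{0,1}²`. -/
structure EdgeProbs where
  p11 : ℝ
  p10 : ℝ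
  p01 : ℝ
  p00 : ℝ
  p11_nonneg : 0 ≤ p11
  p10_nonneg : 0 ≤ p10
  p01_nonneg : 0 ≤ p01
  p00_nonneg : 0 ≤ p00
  sum_eq_one : p11 + p10 + p01 + p00 = 1

/-- The probability of the label `(G_a(e), G_b(e))`, with `true` for "edge present". -/
def EdgeProbs.prob (p : EdgeProbs) : Bool × Bool → ℝ
  | (true, true) => p.p11
  | (true, false) => p.p10
  | (false, true) => p.p01
  | (false, false) => p.p00

theorem EdgeProbs.prob_nonneg (p : EdgeProbs) (x : Bool × Bool) : 0 ≤ p.prob x := by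
  rcases x with ⟨a, b⟩
  cases a <;> cases b
  exacts [p.p00_nonneg, p.p01_nonneg, p.p10_nonneg, p.p11_nonneg]

theorem EdgeProbs.sum_prob (p : EdgeProbs) : ∑ x : Bool × Bool, p.prob x = 1 := by
  simp only [Fintype.sum_prod_type, Fintype.sum_bool, EdgeProbs.prob]
  linarith [p.sum_eq_one]

/-- The law of the label of a single vertex pair. -/
noncomputable def labelPMF (p : EdgeProbs) : PMF (Bool × Bool) :=
  PMF.ofFintype (fun x => ENNReal.ofReal (p.prob x)) (by
    rw [← ENNReal.ofReal_sum_of_nonneg (fun x _ => p.prob_nonneg x), p.sum_prob,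
      ENNReal.ofReal_one])

/-- The unordered pairs of distinct vertices of `{0, …, n-1}`. -/
abbrev VertexPair (n : ℕ) : Type := {e : Sym2 (Fin n) // ¬ e.IsDiag}

/-- The law of the family of labels of all vertex pairs, which are i.i.d. with law `labelPMF p`. -/
noncomputable def labelingPMF (p : EdgeProbs) (n : ℕ) : PMF (VertexPair n → Bool × Bool) :=
  PMF.ofFintype (fun f => ∏ e, labelPMF p (f e)) (by
    rw [← Fintype.prod_sum (fun (_ : VertexPair n) x => labelPMF p x)]
    have h : ∑ x, labelPMF p x = 1 := by
      rw [← tsum_fintype (L := .unconditional _)]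
      exact (labelPMF p).tsum_coe
    simp [h])

/-- The graph on `{0, …, n-1}` with edge indicator function `f`. -/
def graphOf {n : ℕ} (f : VertexPair n → Bool) : SimpleGraph (Fin n) :=
  SimpleGraph.fromEdgeSet {e | ∃ h : ¬ e.IsDiag, f ⟨e, h⟩ = true}

/-- The distribution `ER(n, p)` of the pair of correlated graphs `(G_a, G_b)`. -/
noncomputable def correlatedER (p : EdgeProbs) (n : ℕ) :
    PMF (SimpleGraph (Fin n) × SimpleGraph (Fin n)) :=
  (labelingPMF p n).map fun f => (graphOf fun e => (f e).1, graphOf fun e => (f e).2)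

/-- The joint law of `((G_a, G_b), Π)`: the pair `(G_a, G_b)` has law `ER(n, p)`, and `Π` is a
uniformly random permutation of the vertices, independent of `(G_a, G_b)`. -/
noncomputable def modelPMF (p : EdgeProbs) (n : ℕ) :
    PMF ((SimpleGraph (Fin n) × SimpleGraph (Fin n)) × Equiv.Perm (Fin n)) :=
  (correlatedER p n).bind fun g =>
    (PMF.uniformOfFintype (Equiv.Perm (Fin n))).map fun σ => (g, σ)

/-- The anonymization `G_c` of `G_a` by `σ`: `{σ i, σ j}` is an edge of `G_c` if and only if
`{i, j}` is an edge of `G_a`. -/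
def anonymize {n : ℕ} (ga : SimpleGraph (Fin n)) (σ : Equiv.Perm (Fin n)) :
    SimpleGraph (Fin n) :=
  ga.map σ

/-- An estimator of the hidden permutation: a function of the observed pair `(G_c, G_b)`. -/
abbrev Estimator (n : ℕ) : Type :=
  SimpleGraph (Fin n) → SimpleGraph (Fin n) → Equiv.Perm (Fin n)

/-- The probability that the estimate computed from `(G_c, G_b)` equals `Π`. -/
noncomputable def successProb (p : EdgeProbs) {n : ℕ} (est : Estimator n) : ℝ :=
  ((modelPMF p n).toOuterMeasure
    {x | est (anonymize x.1.1 x.2) x.1.2 = x.2}).toReal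

end GraphAlignment

/-! Achievability. The estimator maximizes the overlap, the number of edges common to `G_b` and the
relabelled `G_c`. It can fail only if some σ ≠ 1, acting on vertex pairs as τ = `pairPerm σ`, does
not decrease the overlap of a with b (`exists_estimator`). A union bound over σ is combined with a
Chernoff bound on the generating function in which x marks the gain of overlap and y the original
overlap on the support of τ. This expectation is a product over the cycles of τ, a cycle of length m
≥ 2 contributing tr T^m for a nonnegative 2×2 matrix T (`transfer`). The bound tr T² ≤ s² forces tr
T^m ≤ s^m, so the expectation is at most s^|supp τ| whatever the cycle type (`cyclicSum_le`). With x
= log n, tr T² ≤ 1 - 2 p₁₁(1 - 5C y²/log n) (`trace_transfer_sq_le`). Let k be the number of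
vertices moved by σ; there are at most n^k such σ. If k ≤ 16n/log n, take y = 1: at least k(n-k)
pairs move, and n^k exp(-p₁₁k(n-k)(1 - 5C/log n)) is geometrically small since n p₁₁ - log n → ∞.
For k near n only about kn/2 pairs move, which is too few. There one first discards the unlikely
event that some large vertex set touches few common edges, and then uses y = e^32 to charge for the
many common edges that are present.

Converse. Under positive correlation the likelihood is monotone in the overlap
(`weight_le_weight_comp`). Swapping two vertices isolated in the intersection graph does not
decrease the overlap, so with X isolated vertices the true permutation has at least X - 1 rivals
that are at least as likely, and no estimator succeeds with posterior probability above 1/X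
(`successProb_le`). Chebyshev's inequality shows that X is large with high probability, its mean n(1
- p₁₁)^(n-1) tending to infinity. -/

namespace GraphAlignment

/-! ### Generating functions along the cycles of a permutation. -/

section CyclicSum

/-- The sum over colourings `a` of the product of the matrix entries `N e (a e) (a (σ e))`. -/
noncomputable def cyclicSum {V ι : Type} [Fintype V] [DecidableEq V] [Fintype ι] (σ : Equiv.Perm V)
    (N : V → Matrix ι ι ℝ) : ℝ :=
  ∑ a : V → ι, ∏ e, N e (a e) (a (σ e))

theorem cyclicSum_congr_equiv {V W ι : Type} [Fintype V] [Fintype W] [DecidableEq V]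
    [DecidableEq W] [Fintype ι] (φ : V ≃ W)
    (σ : Equiv.Perm W) (N : W → Matrix ι ι ℝ) :
    cyclicSum ((φ.trans σ).trans φ.symm) (N ∘ φ) = cyclicSum σ N := by
  unfold cyclicSum
  refine Fintype.sum_equiv (φ.arrowCongr (Equiv.refl ι)) _ _ fun a => ?_
  refine Fintype.prod_equiv φ _ _ fun e => ?_
  simp [Equiv.arrowCongr]

theorem cyclicSum_nonneg {V ι : Type} [Fintype V] [DecidableEq V] [Fintype ι] (σ : Equiv.Perm V)
    {N : V → Matrix ι ι ℝ} (hN : ∀ e i j, 0 ≤ N e i j) : 0 ≤ cyclicSum σ N :=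
  Finset.sum_nonneg fun _ _ => Finset.prod_nonneg fun _ _ => hN _ _ _

theorem cyclicSum_optionCongr {V ι : Type} [Fintype V] [DecidableEq V] [Fintype ι]
    (τ : Equiv.Perm V)
    (N : Option V → Matrix ι ι ℝ) :
    cyclicSum (Equiv.optionCongr τ) N = (N none).trace * cyclicSum τ (fun e => N (some e)) := by
  unfold cyclicSum
  refine (Fintype.sum_equiv (Equiv.piOptionEquivProd (β := fun _ => ι)) _
    (fun x => N none x.1 x.1 * ∏ e, N (some e) (x.2 e) (x.2 (τ e)))
    (fun a => by simp [Fintype.prod_option, Equiv.piOptionEquivProd])).trans ?_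
  rw [Fintype.sum_prod_type, Matrix.trace, Finset.sum_mul_sum]
  rfl

/-- The permutation inserts `none` into the cycle of τ just after c. Summing over the colour of
`none` is a matrix multiplication. -/
theorem cyclicSum_swap_mul_optionCongr {V ι : Type} [Fintype V] [DecidableEq V] [Fintype ι]
    (τ : Equiv.Perm V) (c : V) (N : Option V → Matrix ι ι ℝ) :
    cyclicSum (Equiv.swap none (some (τ c)) * Equiv.optionCongr τ) N =
      cyclicSum τ (Function.update (fun e => N (some e)) c (N (some c) * N none)) := by
  unfold cyclicSum
  refine (Fintype.sum_equiv (Equiv.piOptionEquivProd (β := fun _ => ι)) _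
    (fun x => (N (some c) (x.2 c) x.1 * N none x.1 (x.2 (τ c))) *
      ∏ e ∈ Finset.univ.erase c, N (some e) (x.2 e) (x.2 (τ e))) ?_).trans ?_
  rotate_left
  · rw [Fintype.sum_prod_type, Finset.sum_comm]
    refine Finset.sum_congr rfl fun a _ => ?_
    rw [← Finset.mul_prod_erase _ _ (Finset.mem_univ c)]
    dsimp only
    rw [← Finset.sum_mul]
    congr 1
    · simp [Matrix.mul_apply]
    · refine Finset.prod_congr rfl fun e he => ?_
      rw [Function.update_of_ne (Finset.ne_of_mem_erase he)]
  · intro a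
    rw [Fintype.prod_option, ← Finset.mul_prod_erase _ _ (Finset.mem_univ c), ← mul_assoc]
    congr 1
    · simp [Equiv.piOptionEquivProd, mul_comm]
    · refine Finset.prod_congr rfl fun e he => ?_
      have hne : τ e ≠ τ c := fun h => Finset.ne_of_mem_erase he (τ.injective h)
      simp [Equiv.piOptionEquivProd, Equiv.swap_apply_of_ne_of_ne, hne]

/-- If the traces of the powers `T ^ m`, `m ≥ 2`, are at most `s ^ m`, then the cyclic sum
is at most the product of the corresponding bounds, whatever the cycle structure. -/
theorem cyclicSum_le {ι : Type} [Fintype ι] [DecidableEq ι] {T : Matrix ι ι ℝ} {s : ℝ}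
    (hs : 0 ≤ s) (htr : ∀ m, 2 ≤ m → (T ^ m).trace ≤ s ^ m)
    {V : Type} [Fintype V] [DecidableEq V] (σ : Equiv.Perm V) (N : V → Matrix ι ι ℝ) (r : V → ℝ)
    (hN : ∀ e i j, 0 ≤ N e i j) (hr : ∀ e, 0 ≤ r e)
    (hfix : ∀ e, σ e = e → (N e).trace ≤ r e)
    (hmov : ∀ e, σ e ≠ e → ∃ m, 1 ≤ m ∧ N e = T ^ m ∧ r e = s ^ m) :
    cyclicSum σ N ≤ ∏ e, r e := by
  revert σ N r
  refine Fintype.induction_empty_option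
    (P := fun V [Fintype V] => ∀ [DecidableEq V] (σ : Equiv.Perm V) (N : V → Matrix ι ι ℝ) (r : V → ℝ),
      (∀ e i j, 0 ≤ N e i j) → (∀ e, 0 ≤ r e) → (∀ e, σ e = e → (N e).trace ≤ r e) →
      (∀ e, σ e ≠ e → ∃ m, 1 ≤ m ∧ N e = T ^ m ∧ r e = s ^ m) →
      cyclicSum σ N ≤ ∏ e, r e) ?_ ?_ ?_ V
  · classical
    intro α β _ φ ih _ σ N r hN hr hfix hmov
    let := Fintype.ofEquiv β φ.symm
    have := ih ((φ.trans σ).trans φ.symm) (N ∘ φ) (r ∘ φ) (fun e => hN _) (fun e => hr _)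
      (fun e he => hfix _ (by simpa [Equiv.symm_apply_eq] using he))
      (fun e he => hmov _ (by simpa [Equiv.symm_apply_eq] using he))
    rw [cyclicSum_congr_equiv] at this
    refine this.trans_eq ?_
    exact Fintype.prod_equiv φ _ _ fun e => rfl
  · intro _ σ N r _ _ _ _
    simp [cyclicSum]
  · classical
    intro V _ ih inst σ N r hN hr hfix hmov
    obtain rfl : inst = Option.instDecidableEq := Subsingleton.elim _ _
    -- Either `none` is a fixed point, which splits off a trace, or it is contracted into its
    -- predecessor c. Contraction multiplies matrices, which is why the induction carries powers of
    -- T.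
    obtain ⟨⟨o, τ⟩, rfl⟩ := Equiv.Perm.decomposeOption.symm.surjective σ
    rw [Equiv.Perm.decomposeOption_symm_apply] at hfix hmov ⊢
    rw [Fintype.prod_option]
    cases o with
    | none =>
      rw [Equiv.swap_self, ← Equiv.Perm.one_def, one_mul] at hfix hmov ⊢
      rw [cyclicSum_optionCongr]
      refine mul_le_mul (hfix none (by simp)) (ih _ _ _ (fun e => hN _) (fun e => hr _)
        (fun e he => hfix _ (by simpa using he)) (fun e he => hmov _ (by simpa using he)))
        (cyclicSum_nonneg _ fun e => hN _) (hr _)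
    | some b =>
      obtain ⟨c, rfl⟩ := τ.surjective b
      rw [cyclicSum_swap_mul_optionCongr]
      obtain ⟨m, hm, hNm, hrm⟩ := hmov none (by simp)
      obtain ⟨l, hl, hNl, hrl⟩ := hmov (some c) (by simp)
      have hpow : N (some c) * N none = T ^ (l + m) := by rw [hNl, hNm, pow_add]
      have hlast : ∀ e, e ≠ c →
          ((Equiv.swap none (some (τ c)) * Equiv.optionCongr τ) (some e) = some (τ e)) := by
        intro e he
        have hne : τ e ≠ τ c := fun h => he (τ.injective h)
        simp [Equiv.swap_apply_of_ne_of_ne, hne]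
      refine (ih τ _ (Function.update (fun e => r (some e)) c (s ^ (l + m))) ?_ ?_ ?_ ?_).trans_eq
        ?_
      · intro e i j
        by_cases he : e = c
        · subst he
          rw [Function.update_self, Matrix.mul_apply]
          exact Finset.sum_nonneg fun _ _ => mul_nonneg (hN _ _ _) (hN _ _ _)
        · rw [Function.update_of_ne he]; exact hN _ _ _
      · intro e
        by_cases he : e = c
        · subst he; rw [Function.update_self]; positivity
        · rw [Function.update_of_ne he]; exact hr _
      · intro e hfe
        by_cases he : e = c
        · subst he
          rw [Function.update_self, Function.update_self, hpow]
          -- Contraction may turn c into a fixed point, but then its exponent is at least 2, so the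
          -- missing bound on tr T is never needed.
          exact htr _ (by omega)
        · rw [Function.update_of_ne he, Function.update_of_ne he]
          exact hfix _ (by rw [hlast e he, hfe])
      · intro e hfe
        by_cases he : e = c
        · subst he
          rw [Function.update_self, Function.update_self, hpow]
          exact ⟨l + m, by omega, rfl, rfl⟩
        · rw [Function.update_of_ne he, Function.update_of_ne he]
          exact hmov _ (by rw [hlast e he]; simpa using hfe)
      · rw [← Finset.mul_prod_erase _ _ (Finset.mem_univ c),
          ← Finset.mul_prod_erase Finset.univ (fun e => r (some e)) (Finset.mem_univ c),
          Function.update_self, hrm, hrl, pow_add, ← mul_assoc, mul_comm (s ^ m)]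
        congr 1
        exact Finset.prod_congr rfl fun e he => by
          rw [Function.update_of_ne (Finset.ne_of_mem_erase he)]

/-- The two conditions make u and v the eigenvalues; Cayley–Hamilton gives the power sums and the
traces the same two-term recursion. -/
theorem trace_pow_eq_add_pow (T : Matrix Bool Bool ℝ) {u v : ℝ} (hsum : u + v = T.trace)
    (hsq : u ^ 2 + v ^ 2 = (T ^ 2).trace) (m : ℕ) : (T ^ m).trace = u ^ m + v ^ m := by
  have hprod : T ^ 2 = (u + v) • T - (u * v) • (1 : Matrix Bool Bool ℝ) := by
    have h1 : u + v = T true true + T false false := by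
      rw [hsum, Matrix.trace, Fintype.sum_bool]; rfl
    have h2 : u * v = T true true * T false false - T true false * T false true := by
      have : (T ^ 2).trace = T true true ^ 2 + T false false ^ 2
          + 2 * (T true false * T false true) := by
        simp only [Matrix.trace, Matrix.diag, Fintype.sum_bool, pow_two, Matrix.mul_apply]
        ring
      rw [this] at hsq
      have h3 : (u + v) ^ 2 = (T true true + T false false) ^ 2 := by rw [h1]
      nlinarith
    rw [h1, h2]
    ext i j
    cases i <;> cases j <;>
      simp [pow_two, Matrix.mul_apply] <;> ring
  induction m using Nat.twoStepInduction with
  | zero => simp [Matrix.trace]; norm_num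
  | one => simpa using hsum.symm
  | more m ih0 ih1 =>
    have : T ^ (m + 2) = (u + v) • T ^ (m + 1) - (u * v) • T ^ m := by
      rw [pow_add, hprod, mul_sub, Matrix.mul_smul, Matrix.mul_smul, mul_one, ← pow_succ]
    rw [this, Matrix.trace_sub, Matrix.trace_smul, Matrix.trace_smul, ih0, ih1]
    simp only [smul_eq_mul]
    ring

/-- Nonnegative off-diagonal entries make the discriminant nonnegative, so the eigenvalues u, v are
real. From u² + v² ≤ s² both are at most s in absolute value, and u^m + v^m ≤ (u² + v²) s^(m-2). -/
theorem trace_pow_le {T : Matrix Bool Bool ℝ} (hT : ∀ i j, 0 ≤ T i j) {s : ℝ} (hs : 0 ≤ s)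
    (hsq : (T ^ 2).trace ≤ s ^ 2) {m : ℕ} (hm : 2 ≤ m) : (T ^ m).trace ≤ s ^ m := by
  set d : ℝ := (T true true - T false false) ^ 2 + 4 * (T true false * T false true) with hd
  have hd0 : 0 ≤ d := add_nonneg (sq_nonneg _)
    (mul_nonneg (by norm_num) (mul_nonneg (hT _ _) (hT _ _)))
  have hdd := Real.sq_sqrt hd0
  set u := (T true true + T false false + √d) / 2 with hu
  set v := (T true true + T false false - √d) / 2 with hv
  have h2 : u ^ 2 + v ^ 2 = (T ^ 2).trace := by
    have : (T ^ 2).trace = T true true ^ 2 + T false false ^ 2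
        + 2 * (T true false * T false true) := by
      simp only [Matrix.trace, Matrix.diag, Fintype.sum_bool, pow_two, Matrix.mul_apply]
      ring
    rw [this, hu, hv]
    nlinarith
  have h1 : u + v = T.trace := by
    simp only [Matrix.trace, Matrix.diag, Fintype.sum_bool, hu, hv]; ring
  rw [trace_pow_eq_add_pow T h1 h2]
  have hus : |u| ≤ s := abs_le_of_sq_le_sq (by nlinarith [sq_nonneg v]) hs
  have hvs : |v| ≤ s := abs_le_of_sq_le_sq (by nlinarith [sq_nonneg u]) hs
  obtain ⟨k, rfl⟩ := Nat.exists_eq_add_of_le hm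
  have key : ∀ z : ℝ, |z| ≤ s → z ^ (2 + k) ≤ z ^ 2 * s ^ k := by
    intro z hz
    rw [pow_add]
    refine mul_le_mul_of_nonneg_left ((le_abs_self _).trans ?_) (sq_nonneg _)
    rw [abs_pow]
    exact pow_le_pow_left₀ (abs_nonneg _) hz _
  calc u ^ (2 + k) + v ^ (2 + k) ≤ u ^ 2 * s ^ k + v ^ 2 * s ^ k := add_le_add (key u hus) (key v hvs)
    _ = (T ^ 2).trace * s ^ k := by rw [← add_mul, h2]
    _ ≤ s ^ 2 * s ^ k := mul_le_mul_of_nonneg_right hsq (pow_nonneg hs _)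
    _ = s ^ (2 + k) := (pow_add _ _ _).symm

end CyclicSum

/-! ### The model as finite sums over edge indicators. -/

section Model

/-- The permutation of vertex pairs induced by a permutation of the vertices. -/
def pairPerm {n : ℕ} (σ : Equiv.Perm (Fin n)) : Equiv.Perm (VertexPair n) where
  toFun e := ⟨e.1.map σ, by rw [Sym2.isDiag_map σ.injective]; exact e.2⟩
  invFun e := ⟨e.1.map σ.symm, by rw [Sym2.isDiag_map σ.symm.injective]; exact e.2⟩
  left_inv e := by ext1; simp [Sym2.map_map]
  right_inv e := by ext1; simp [Sym2.map_map]

theorem pairPerm_coe {n : ℕ} (σ : Equiv.Perm (Fin n)) (e : VertexPair n) :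
    (pairPerm σ e).1 = e.1.map σ := rfl

theorem pairPerm_mul {n : ℕ} (σ τ : Equiv.Perm (Fin n)) :
    pairPerm (σ * τ) = pairPerm σ * pairPerm τ := by
  ext1 e
  apply Subtype.ext
  simp [pairPerm_coe, Sym2.map_map]

theorem pairPerm_one {n : ℕ} : pairPerm (1 : Equiv.Perm (Fin n)) = 1 := by
  ext1 e
  apply Subtype.ext
  simp [pairPerm_coe]

theorem mem_edgeSet_graphOf {n : ℕ} (f : VertexPair n → Bool) (e : VertexPair n) :
    e.1 ∈ (graphOf f).edgeSet ↔ f e = true := by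
  rw [graphOf, SimpleGraph.edgeSet_fromEdgeSet]
  simp [e.2]

open Classical in
/-- The edge indicator function of a graph. -/
noncomputable def edgeIndicator {n : ℕ} (G : SimpleGraph (Fin n)) (e : VertexPair n) : Bool :=
  decide (e.1 ∈ G.edgeSet)

theorem edgeIndicator_graphOf {n : ℕ} (f : VertexPair n → Bool) :
    edgeIndicator (graphOf f) = f := by
  funext e
  rw [Bool.eq_iff_iff, ← mem_edgeSet_graphOf f e]
  simp only [edgeIndicator, decide_eq_true_eq]

theorem anonymize_graphOf {n : ℕ} (f : VertexPair n → Bool) (σ : Equiv.Perm (Fin n)) :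
    anonymize (graphOf f) σ = graphOf (f ∘ pairPerm σ⁻¹) := by
  ext i j
  rw [anonymize, ← Equiv.coe_toEmbedding, SimpleGraph.map_adj]
  simp only [Equiv.coe_toEmbedding]
  constructor
  · rintro ⟨u, v, huv, rfl, rfl⟩
    have hne : ¬ (s(u, v) : Sym2 (Fin n)).IsDiag := by simpa using huv.ne
    have := (mem_edgeSet_graphOf f ⟨s(u, v), hne⟩).1 huv
    have hne' : ¬ (s(σ u, σ v) : Sym2 (Fin n)).IsDiag := by simpa using huv.ne
    refine (mem_edgeSet_graphOf (f ∘ pairPerm σ⁻¹) ⟨s(σ u, σ v), hne'⟩).2 ?_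
    rw [Function.comp_apply, ← this]
    congr 1
    apply Subtype.ext
    simp [pairPerm_coe]
  · intro hij
    have hne : ¬ (s(i, j) : Sym2 (Fin n)).IsDiag := by simpa using hij.ne
    have := (mem_edgeSet_graphOf (f ∘ pairPerm σ⁻¹) ⟨s(i, j), hne⟩).1 hij
    refine ⟨σ⁻¹ i, σ⁻¹ j, ?_, by simp, by simp⟩
    exact (mem_edgeSet_graphOf f (pairPerm σ⁻¹ ⟨s(i, j), hne⟩)).2 this

/-- The probability that the edge indicators of `(G_a, G_b)` are `(a, b)`. -/
def weight {V : Type} [Fintype V] (p : EdgeProbs) (a b : V → Bool) : ℝ :=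
  ∏ e, p.prob (a e, b e)

theorem weight_nonneg {V : Type} [Fintype V] (p : EdgeProbs) (a b : V → Bool) :
    0 ≤ weight p a b :=
  Finset.prod_nonneg fun _ _ => p.prob_nonneg _

/-- Expectations of products over the vertex pairs factorize. -/
theorem sum_sum_weight_mul_prod {V : Type} [Fintype V] [DecidableEq V] (p : EdgeProbs)
    (g : V → Bool → Bool → ℝ) :
    ∑ a : V → Bool, ∑ b : V → Bool, weight p a b * ∏ e, g e (a e) (b e) =
      ∏ e, ∑ x : Bool, ∑ y : Bool, p.prob (x, y) * g e x y := by
  rw [Finset.prod_univ_sum, Fintype.piFinset_univ]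
  refine Finset.sum_congr rfl fun a _ => ?_
  rw [Finset.prod_univ_sum, Fintype.piFinset_univ]
  refine Finset.sum_congr rfl fun b _ => ?_
  rw [weight, Finset.prod_mul_distrib]

theorem sum_sum_weight {V : Type} [Fintype V] [DecidableEq V] (p : EdgeProbs) :
    ∑ a : V → Bool, ∑ b : V → Bool, weight p a b = 1 := by
  have h := sum_sum_weight_mul_prod (V := V) p (fun _ _ _ => 1)
  simp only [Finset.prod_const_one, mul_one] at h
  rw [h, Finset.prod_eq_one]
  intro e _
  rw [← Fintype.sum_prod_type (f := p.prob)]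
  exact p.sum_prob

open Classical in
/-- The probability of an event of the edge indicators of `(G_a, G_b)`. -/
noncomputable def eventProb {V : Type} [Fintype V] [DecidableEq V] (p : EdgeProbs)
    (E : (V → Bool) → (V → Bool) → Prop) : ℝ :=
  ∑ a : V → Bool, ∑ b : V → Bool, if E a b then weight p a b else 0

theorem labelingPMF_apply_toReal (p : EdgeProbs) (n : ℕ) (f : VertexPair n → Bool × Bool) :
    (labelingPMF p n f).toReal = weight p (fun e => (f e).1) (fun e => (f e).2) := by
  rw [labelingPMF, PMF.ofFintype_apply, ENNReal.toReal_prod]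
  refine Finset.prod_congr rfl fun e _ => ?_
  rw [labelPMF, PMF.ofFintype_apply, ENNReal.toReal_ofReal (p.prob_nonneg _)]

-- This replaces the `PMF` monad by real finite sums: condition on Π = σ and average over σ.
open Classical in
theorem successProb_eq_sum (p : EdgeProbs) {n : ℕ} (est : Estimator n) :
    successProb p est = (∑ σ : Equiv.Perm (Fin n), eventProb p fun a b =>
      est (graphOf (a ∘ pairPerm σ⁻¹)) (graphOf b) = σ) / (n.factorial : ℝ) := by
  have hcard : (Fintype.card (Equiv.Perm (Fin n)) : ℝ) = n.factorial := by
    rw [Fintype.card_perm, Fintype.card_fin]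
  rw [successProb, modelPMF, correlatedER, PMF.bind_map, PMF.toOuterMeasure_bind_apply,
    tsum_fintype, ENNReal.toReal_sum]
  · simp only [eventProb]
    rw [Finset.sum_comm, Finset.sum_div]
    rw [Fintype.sum_equiv (Equiv.arrowProdEquivProdArrow (VertexPair n) (fun _ => Bool)
      (fun _ => Bool)) _ (fun x : (VertexPair n → Bool) × (VertexPair n → Bool) =>
      weight p x.1 x.2 * ((∑ σ : Equiv.Perm (Fin n),
        if est (graphOf (x.1 ∘ pairPerm σ⁻¹)) (graphOf x.2) = σ then 1 else 0) /
          (n.factorial : ℝ)))]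
    · rw [Fintype.sum_prod_type]
      refine Finset.sum_congr rfl fun a _ => ?_
      rw [Finset.sum_comm, Finset.sum_div]
      refine Finset.sum_congr rfl fun b _ => ?_
      rw [mul_div_assoc', Finset.mul_sum]
      simp only [mul_ite, mul_one, mul_zero]
      congr!
    · intro f
      rw [ENNReal.toReal_mul, labelingPMF_apply_toReal]
      congr 1
      rw [Function.comp_apply, PMF.toOuterMeasure_map_apply, PMF.toOuterMeasure_apply_fintype,
        ENNReal.toReal_sum]
      · rw [Finset.sum_div]
        refine Finset.sum_congr rfl fun σ _ => ?_
        have hmem : σ ∈ (fun σ : Equiv.Perm (Fin n) =>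
            ((graphOf fun e => (f e).1, graphOf fun e => (f e).2), σ)) ⁻¹'
            {x | est (anonymize x.1.1 x.2) x.1.2 = x.2} ↔
            est (graphOf ((fun e => (f e).1) ∘ pairPerm σ⁻¹)) (graphOf fun e => (f e).2) = σ := by
          rw [← anonymize_graphOf]; rfl
        by_cases h : est (graphOf ((fun e => (f e).1) ∘ pairPerm σ⁻¹))
            (graphOf fun e => (f e).2) = σ
        · rw [Set.indicator_of_mem (hmem.2 h), PMF.uniformOfFintype_apply, ENNReal.toReal_inv,
            ENNReal.toReal_natCast, hcard, ← one_div]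
          congr 1
          exact (if_pos h).symm
        · rw [Set.indicator_of_notMem (mt hmem.1 h), ENNReal.toReal_zero]
          refine (zero_div (n.factorial : ℝ)).symm.trans ?_
          congr 1
          exact (if_neg h).symm
      · intro σ _
        refine ne_top_of_le_ne_top (PMF.apply_ne_top (PMF.uniformOfFintype _) σ)
          (Set.indicator_le_self _ _ _)
  · intro f _
    refine ENNReal.mul_ne_top (PMF.apply_ne_top _ _) ?_
    rw [Function.comp_apply]
    refine ne_top_of_le_ne_top ENNReal.one_ne_top ?_
    rw [PMF.toOuterMeasure_apply, ← PMF.tsum_coe]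
    exact ENNReal.tsum_le_tsum fun x => Set.indicator_le_self _ _ _

end Model

/-! ### Elementary probability: Markov, monotonicity, union bounds. -/

section EventProb

variable {V : Type} [Fintype V] [DecidableEq V]

theorem eventProb_le_of_one_le (p : EdgeProbs) {E : (V → Bool) → (V → Bool) → Prop}
    {g : (V → Bool) → (V → Bool) → ℝ} (hg : ∀ a b, 0 ≤ g a b) (hE : ∀ a b, E a b → 1 ≤ g a b) :
    eventProb p E ≤ ∑ a : V → Bool, ∑ b : V → Bool, weight p a b * g a b := by
  refine Finset.sum_le_sum fun a _ => Finset.sum_le_sum fun b _ => ?_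
  split_ifs with h
  · exact le_mul_of_one_le_right (weight_nonneg _ _ _) (hE a b h)
  · exact mul_nonneg (weight_nonneg _ _ _) (hg a b)

theorem eventProb_mono (p : EdgeProbs) {E F : (V → Bool) → (V → Bool) → Prop}
    (h : ∀ a b, E a b → F a b) : eventProb p E ≤ eventProb p F := by
  refine Finset.sum_le_sum fun a _ => Finset.sum_le_sum fun b _ => ?_
  by_cases hE : E a b
  · rw [if_pos hE, if_pos (h a b hE)]
  · rw [if_neg hE]
    split_ifs
    · exact weight_nonneg _ _ _
    · exact le_rfl

theorem eventProb_le_one (p : EdgeProbs) (E : (V → Bool) → (V → Bool) → Prop) :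
    eventProb p E ≤ 1 := by
  refine (eventProb_le_of_one_le p (g := fun _ _ => 1) (fun _ _ => zero_le_one)
    fun _ _ _ => le_rfl).trans_eq ?_
  simp only [mul_one]
  exact sum_sum_weight p

theorem eventProb_not (p : EdgeProbs) (E : (V → Bool) → (V → Bool) → Prop) :
    eventProb p (fun a b => ¬ E a b) = 1 - eventProb p E := by
  rw [eq_sub_iff_add_eq, ← sum_sum_weight (V := V) p, eventProb, eventProb,
    ← Finset.sum_add_distrib]
  refine Finset.sum_congr rfl fun a _ => ?_
  rw [← Finset.sum_add_distrib]
  refine Finset.sum_congr rfl fun b _ => ?_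
  by_cases h : E a b <;> simp [h]

theorem eventProb_or_le (p : EdgeProbs) (E F : (V → Bool) → (V → Bool) → Prop) :
    eventProb p (fun a b => E a b ∨ F a b) ≤ eventProb p E + eventProb p F := by
  simp only [eventProb]
  rw [← Finset.sum_add_distrib]
  refine Finset.sum_le_sum fun a _ => ?_
  rw [← Finset.sum_add_distrib]
  refine Finset.sum_le_sum fun b _ => ?_
  have := weight_nonneg p a b
  by_cases hE : E a b <;> by_cases hF : F a b <;> simp [hE, hF, this]

theorem eventProb_exists_le {κ : Type} (p : EdgeProbs) (s : Finset κ)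
    (E : κ → (V → Bool) → (V → Bool) → Prop) :
    eventProb p (fun a b => ∃ k ∈ s, E k a b) ≤ ∑ k ∈ s, eventProb p (E k) := by
  classical
  induction s using Finset.induction_on with
  | empty => simp [eventProb]
  | insert k s hk ih =>
    rw [Finset.sum_insert hk]
    refine (eventProb_mono p ?_).trans
      ((eventProb_or_le p (E k) (fun a b => ∃ k ∈ s, E k a b)).trans (by gcongr))
    simp

end EventProb

/-! ### Chernoff bounds for the overlap. -/

section Overlap

/-- The number of `e ∈ U` with `a e = b e = true`. -/
def overlapOn {V : Type} (U : Finset V) (a b : V → Bool) : ℕ :=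
  (U.filter fun e => a e = true ∧ b e = true).card

theorem overlapOn_eq_sum {V : Type} (U : Finset V) (a b : V → Bool) :
    overlapOn U a b = ∑ e ∈ U, if a e = true ∧ b e = true then 1 else 0 :=
  Finset.card_filter _ _

variable {V : Type} [Fintype V] [DecidableEq V]

/-- The entry of the transfer matrix of the generating function of the overlap difference. -/
noncomputable def transfer (p : EdgeProbs) (x y : ℝ) : Matrix Bool Bool ℝ := fun i j =>
  ∑ l : Bool, p.prob (i, l) *
    ((if j = true ∧ l = true then x else 1) * (if i = true ∧ l = true then y / x else 1))

theorem transfer_nonneg (p : EdgeProbs) {x y : ℝ} (hx : 0 ≤ x) (hy : 0 ≤ y) (i j : Bool) :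
    0 ≤ transfer p x y i j := by
  refine Finset.sum_nonneg fun l _ => mul_nonneg (p.prob_nonneg _) (mul_nonneg ?_ ?_)
  · split_ifs
    · exact hx
    · exact zero_le_one
  · split_ifs
    · exact div_nonneg hy hx
    · exact zero_le_one

theorem trace_transfer_sq (p : EdgeProbs) {x : ℝ} (hx : x ≠ 0) (y : ℝ) :
    ((transfer p x y) ^ 2).trace = (p.p00 + p.p01) ^ 2 + (p.p10 + p.p11 * y) ^ 2 +
      2 * ((p.p00 + p.p01 * x) * (p.p10 + p.p11 * (y / x))) := by
  simp only [Matrix.trace, Matrix.diag, Fintype.sum_bool, pow_two, Matrix.mul_apply, transfer,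
    EdgeProbs.prob]
  simp
  field_simp
  ring

/-- Summing out b first leaves a factor depending only on `a e` and `a (σ e)`, hence a cyclic sum
over a. -/
theorem sum_weight_mul_prod_transfer_le (p : EdgeProbs) (σ : Equiv.Perm V) {x y s : ℝ}
    (hx : 0 < x) (hy : 0 ≤ y) (hs : 0 ≤ s) (hq : ((transfer p x y) ^ 2).trace ≤ s ^ 2) :
    ∑ a : V → Bool, ∑ b : V → Bool, weight p a b *
      ∏ e, (if σ e = e then 1 else (if a (σ e) = true ∧ b e = true then x else 1) *
        (if a e = true ∧ b e = true then y / x else 1)) ≤ s ^ σ.support.card := by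
  have hT := transfer_nonneg p hx.le hy
  obtain ⟨M, hM1, hM2⟩ : ∃ M : V → Matrix Bool Bool ℝ,
      (∀ e, σ e = e → ∀ i j, M e i j = ∑ l : Bool, p.prob (i, l)) ∧
      (∀ e, σ e ≠ e → M e = transfer p x y) :=
    -- At a fixed point only the diagonal is ever evaluated; constant rows make the trace the total
    -- mass 1.
    ⟨fun e => if σ e = e then Matrix.of (fun i _ => ∑ l : Bool, p.prob (i, l))
      else transfer p x y, fun e he i j => by simp [he], fun e he => if_neg he⟩
  have key : ∑ a : V → Bool, ∑ b : V → Bool, weight p a b *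
      ∏ e, (if σ e = e then 1 else (if a (σ e) = true ∧ b e = true then x else 1) *
        (if a e = true ∧ b e = true then y / x else 1)) = cyclicSum σ M := by
    refine Finset.sum_congr rfl fun a _ => ?_
    have : ∀ e : V, M e (a e) (a (σ e)) =
        ∑ l : Bool, p.prob (a e, l) * (if σ e = e then 1 else
          (if a (σ e) = true ∧ l = true then x else 1) *
          (if a e = true ∧ l = true then y / x else 1)) := by
      intro e
      by_cases he : σ e = e
      · rw [hM1 e he]
        simp only [he, if_true, mul_one]
      · rw [hM2 e he]
        simp only [he, if_false, transfer]
    simp only [this]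
    rw [Finset.prod_univ_sum, Fintype.piFinset_univ]
    refine Finset.sum_congr rfl fun b _ => ?_
    rw [weight, Finset.prod_mul_distrib]
  rw [key]
  refine (cyclicSum_le hs (fun m hm => trace_pow_le hT hs hq hm) σ M
    (fun e => if σ e = e then 1 else s) ?_ ?_ ?_ ?_).trans_eq ?_
  · intro e i j
    by_cases he : σ e = e
    · rw [hM1 e he]
      exact Finset.sum_nonneg fun l _ => p.prob_nonneg _
    · rw [hM2 e he]
      exact hT i j
  · intro e
    split_ifs
    · exact zero_le_one
    · exact hs
  · intro e he
    simp only [he, if_true, Matrix.trace, Matrix.diag, hM1 e he]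
    rw [← Fintype.sum_prod_type (f := p.prob)]
    exact p.sum_prob.le
  · intro e he
    exact ⟨1, le_rfl, by rw [hM2 e he, pow_one], by simp [he]⟩
  · rw [Finset.prod_ite, Finset.prod_const_one, one_mul, Finset.prod_const]
    rfl

/-- Chernoff bound for the event that `σ` preserves the overlap although the overlap on the
support of `σ` is at least `m`. -/
theorem eventProb_overlapOn_le (p : EdgeProbs) (σ : Equiv.Perm V) {x t s : ℝ} (m : ℝ)
    (hx : 1 ≤ x) (ht : 0 ≤ t) (hs : 0 ≤ s)
    (hq : ((transfer p x (Real.exp t)) ^ 2).trace ≤ s ^ 2) :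
    eventProb p (fun a b => overlapOn Finset.univ a b ≤ overlapOn Finset.univ (a ∘ σ) b ∧
      m ≤ overlapOn σ.support a b) ≤ Real.exp (-(t * m)) * s ^ σ.support.card := by
  have hx0 : 0 < x := by linarith
  have hprod : ∀ a b : V → Bool,
      ∏ e, (if σ e = e then 1 else (if a (σ e) = true ∧ b e = true then x else 1) *
        (if a e = true ∧ b e = true then Real.exp t / x else 1)) =
      x ^ overlapOn σ.support (a ∘ σ) b * (Real.exp t / x) ^ overlapOn σ.support a b := by
    intro a b
    rw [Finset.prod_ite, Finset.prod_const_one, one_mul]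
    change ∏ e ∈ σ.support, _ = _
    rw [Finset.prod_mul_distrib]
    congr 1
    · rw [overlapOn, Finset.prod_ite, Finset.prod_const_one, mul_one, Finset.prod_const]
      rfl
    · rw [overlapOn, Finset.prod_ite, Finset.prod_const_one, mul_one, Finset.prod_const]
  refine (eventProb_le_of_one_le p (g := fun a b => Real.exp (-(t * m)) *
    (x ^ overlapOn σ.support (a ∘ σ) b * (Real.exp t / x) ^ overlapOn σ.support a b))
    (fun a b => by positivity) ?_).trans ?_
  -- Off the support of σ the two overlaps agree, so the comparison holds on the support. There the
  -- exponent of x is nonnegative after cancellation, and y = exp t contributes at least exp(tm).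
  · rintro a b ⟨h1, h2⟩
    have hsplit : ∀ c : V → Bool, overlapOn Finset.univ c b =
        overlapOn σ.support c b + overlapOn σ.supportᶜ c b := fun c => by
      simp only [overlapOn_eq_sum]
      exact (Finset.sum_add_sum_compl _ _).symm
    have hcompl : overlapOn σ.supportᶜ (a ∘ σ) b = overlapOn σ.supportᶜ a b := by
      simp only [overlapOn_eq_sum]
      refine Finset.sum_congr rfl fun e he => ?_
      have : σ e = e := by simpa using he
      simp [this]
    have h3 : overlapOn σ.support a b ≤ overlapOn σ.support (a ∘ σ) b := by
      rw [hsplit a, hsplit (a ∘ σ), hcompl] at h1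
      omega
    calc (1 : ℝ) = Real.exp (-(t * m)) * Real.exp (t * m) := by rw [← Real.exp_add]; simp
      _ ≤ Real.exp (-(t * m)) * (Real.exp t) ^ overlapOn σ.support a b := by
        rw [← Real.exp_nat_mul, mul_comm _ t]
        gcongr
      _ = Real.exp (-(t * m)) * (x ^ overlapOn σ.support a b *
          (Real.exp t / x) ^ overlapOn σ.support a b) := by
        rw [← mul_pow, mul_div_cancel₀ _ hx0.ne']
      _ ≤ _ := by gcongr
  · have := sum_weight_mul_prod_transfer_le p σ hx0 (Real.exp_pos t).le hs hq
    simp only [hprod] at this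
    calc _ = Real.exp (-(t * m)) * ∑ a : V → Bool, ∑ b : V → Bool, weight p a b *
          (x ^ overlapOn σ.support (a ∘ σ) b * (Real.exp t / x) ^ overlapOn σ.support a b) := by
          simp only [Finset.mul_sum]
          refine Finset.sum_congr rfl fun a _ => Finset.sum_congr rfl fun b _ => by ring
      _ ≤ _ := by gcongr

/-- Chernoff bound for the lower tail of the overlap on a fixed set. -/
theorem eventProb_overlapOn_lt_le (p : EdgeProbs) (U : Finset V) (m : ℝ) :
    eventProb p (fun a b => (overlapOn U a b : ℝ) < m) ≤
      Real.exp (m - p.p11 * U.card / 2) := by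
  have hprod : ∀ a b : V → Bool,
      ∏ e, (if e ∈ U then (if a e = true ∧ b e = true then Real.exp (-1) else 1) else 1) =
      Real.exp (-1) ^ overlapOn U a b := by
    intro a b
    rw [← Finset.prod_filter, Finset.filter_univ_mem, overlapOn, Finset.prod_ite,
      Finset.prod_const_one, mul_one, Finset.prod_const]
  have h := sum_sum_weight_mul_prod (V := V) p
    (fun e i j => if e ∈ U then (if i = true ∧ j = true then Real.exp (-1) else 1) else 1)
  simp only [hprod] at h
  refine (eventProb_le_of_one_le p (g := fun a b => Real.exp m *
    Real.exp (-1) ^ overlapOn U a b) (fun a b => by positivity) ?_).trans ?_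
  · intro a b hab
    rw [← Real.exp_nat_mul, ← Real.exp_add]
    exact Real.one_le_exp (by linarith)
  · have hsum := p.sum_eq_one
    have hfac : ∀ e : V, ∑ i : Bool, ∑ j : Bool, p.prob (i, j) *
        (if e ∈ U then (if i = true ∧ j = true then Real.exp (-1) else 1) else 1) ≤
        if e ∈ U then Real.exp (-(p.p11 / 2)) else 1 := by
      intro e
      simp only [Fintype.sum_bool, EdgeProbs.prob]
      by_cases he : e ∈ U
      · simp only [he, if_true]
        -- Each pair in U contributes 1 - p₁₁(1 - 1/e) ≤ 1 - p₁₁/2 ≤ exp(-p₁₁/2).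
        have h1 : Real.exp (-1) ≤ 1 / 2 := by
          have := Real.exp_neg_one_lt_d9
          linarith
        have h2 := Real.add_one_le_exp (-(p.p11 / 2))
        have := p.p11_nonneg
        simp
        nlinarith
      · simp [he]
        linarith
    calc _ = Real.exp m * ∑ a : V → Bool, ∑ b : V → Bool, weight p a b *
          Real.exp (-1) ^ overlapOn U a b := by
          simp only [Finset.mul_sum]
          refine Finset.sum_congr rfl fun a _ => Finset.sum_congr rfl fun b _ => by ring
      _ ≤ Real.exp m * ∏ e, (if e ∈ U then Real.exp (-(p.p11 / 2)) else 1) := by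
          rw [h]
          refine mul_le_mul_of_nonneg_left ?_ (Real.exp_pos _).le
          refine Finset.prod_le_prod (fun e _ => ?_) (fun e _ => hfac e)
          refine Finset.sum_nonneg fun i _ => Finset.sum_nonneg fun j _ =>
            mul_nonneg (p.prob_nonneg _) ?_
          split_ifs <;> positivity
      _ = _ := by
          rw [← Finset.prod_filter, Finset.filter_univ_mem, Finset.prod_const,
            ← Real.exp_nat_mul, ← Real.exp_add]
          congr 1
          ring

end Overlap

/-! ### Counting permutations, moved pairs and touched pairs. -/

section Counting

variable {n : ℕ}

/-- Choose the support, then permute it arbitrarily: C(n,k) k! is a falling factorial. -/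
theorem card_filter_card_support_le (k : ℕ) :
    (Finset.univ.filter fun σ : Equiv.Perm (Fin n) => σ.support.card = k).card ≤ n ^ k := by
  classical
  have hS : ∀ S : Finset (Fin n),
      (Finset.univ.filter fun σ : Equiv.Perm (Fin n) => σ.support ⊆ S).card =
        S.card.factorial := by
    intro S
    rw [← Fintype.card_subtype, ← Fintype.card_coe S, ← Fintype.card_perm]
    refine (Fintype.card_congr ((Equiv.Perm.subtypeEquivSubtypePerm (· ∈ S)).trans
      (Equiv.subtypeEquivRight fun σ => ?_))).symm
    rw [Finset.subset_iff]
    refine forall_congr' fun i => ?_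
    rw [Equiv.Perm.mem_support]
    exact not_imp_comm
  calc _ ≤ ((Finset.powersetCard k Finset.univ).biUnion fun S : Finset (Fin n) =>
        Finset.univ.filter fun σ : Equiv.Perm (Fin n) => σ.support ⊆ S).card := by
        refine Finset.card_le_card fun σ hσ => ?_
        simp only [Finset.mem_filter, Finset.mem_univ, true_and] at hσ
        simp only [Finset.mem_biUnion, Finset.mem_powersetCard, Finset.mem_filter,
          Finset.mem_univ, true_and, Finset.subset_univ]
        exact ⟨σ.support, hσ, subset_rfl⟩
    _ ≤ ∑ S ∈ Finset.powersetCard k (Finset.univ : Finset (Fin n)), k.factorial := by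
        refine Finset.card_biUnion_le.trans (Finset.sum_le_sum fun S hS' => ?_)
        rw [hS, (Finset.mem_powersetCard.1 hS').2]
    _ = n.descFactorial k := by
        rw [Finset.sum_const, Finset.card_powersetCard, Finset.card_univ, Fintype.card_fin,
          Nat.descFactorial_eq_factorial_mul_choose, smul_eq_mul, mul_comm]
    _ ≤ n ^ k := Nat.descFactorial_le_pow _ _

/-- A sum over nontrivial permutations of terms at most `(u / n) ^ |supp σ|`. -/
theorem sum_perm_le (P : Finset (Equiv.Perm (Fin n))) (hP : 1 ∉ P) {F : Equiv.Perm (Fin n) → ℝ}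
    {u : ℝ} (hu : 0 ≤ u) (hu1 : u ≤ 1 / 2)
    (hF : ∀ σ ∈ P, F σ * (n : ℝ) ^ σ.support.card ≤ u ^ σ.support.card) :
    ∑ σ ∈ P, F σ ≤ 2 * u := by
  classical
  rcases Nat.eq_zero_or_pos n with rfl | hn
  · have : P = ∅ := Finset.eq_empty_of_forall_notMem fun σ hσ =>
      hP (by rwa [Subsingleton.elim σ 1] at hσ)
    rw [this, Finset.sum_empty]
    positivity
  have hn' : (0 : ℝ) < n := by exact_mod_cast hn
  -- Supports of nontrivial permutations are nonempty, so the shift by one starts the geometric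
  -- series at u and yields 2u.
  have hmaps : ∀ σ ∈ P, σ.support.card - 1 ∈ Finset.range n := fun σ _ => by
    have := Finset.card_le_univ σ.support
    rw [Fintype.card_fin] at this
    rw [Finset.mem_range]
    omega
  rw [← Finset.sum_fiberwise_of_maps_to hmaps]
  have hinner : ∀ k ∈ Finset.range n,
      ∑ σ ∈ P.filter (fun σ => σ.support.card - 1 = k), F σ ≤ u ^ (k + 1) := by
    intro k _
    have hcard : ∀ σ ∈ P.filter (fun σ => σ.support.card - 1 = k), σ.support.card = k + 1 := by
      intro σ hσ
      rw [Finset.mem_filter] at hσ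
      have : σ.support.card ≠ 0 := fun h =>
        hP (by rw [Finset.card_eq_zero, Equiv.Perm.support_eq_empty_iff] at h; exact h ▸ hσ.1)
      omega
    calc _ ≤ ∑ σ ∈ P.filter (fun σ => σ.support.card - 1 = k), u ^ (k + 1) / (n : ℝ) ^ (k + 1) := by
          refine Finset.sum_le_sum fun σ hσ => ?_
          rw [le_div_iff₀ (by positivity), ← hcard σ hσ]
          exact hF σ (Finset.mem_filter.1 hσ).1
      _ ≤ (n : ℝ) ^ (k + 1) * (u ^ (k + 1) / (n : ℝ) ^ (k + 1)) := by
          rw [Finset.sum_const, nsmul_eq_mul]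
          gcongr
          have : P.filter (fun σ => σ.support.card - 1 = k) ⊆
              Finset.univ.filter fun σ : Equiv.Perm (Fin n) => σ.support.card = k + 1 :=
            fun σ hσ => by simpa using hcard σ hσ
          exact_mod_cast (Finset.card_le_card this).trans (card_filter_card_support_le (k + 1))
      _ = u ^ (k + 1) := mul_div_cancel₀ _ (by positivity)
  refine (Finset.sum_le_sum hinner).trans ?_
  simp only [pow_succ]
  rw [← Finset.sum_mul]
  refine mul_le_mul_of_nonneg_right ?_ hu
  have hgeom := geom_sum_mul_neg u n
  have : 0 ≤ u ^ n := pow_nonneg hu n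
  have hge : 0 ≤ ∑ i ∈ Finset.range n, u ^ i := Finset.sum_nonneg fun i _ => pow_nonneg hu i
  nlinarith

/-- A pair consisting of a moved and a fixed vertex is always moved. -/
theorem mul_sub_le_card_support_pairPerm (σ : Equiv.Perm (Fin n)) :
    σ.support.card * (n - σ.support.card) ≤ (pairPerm σ).support.card := by
  classical
  have h : σ.support.card * (n - σ.support.card) = (σ.support ×ˢ σ.supportᶜ).card := by
    rw [Finset.card_product, Finset.card_compl, Fintype.card_fin]
  rw [h, ← Finset.card_map (Function.Embedding.subtype _)]
  refine Finset.card_le_card_of_injOn (fun x => s(x.1, x.2)) ?_ ?_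
  · rintro ⟨i, j⟩ hij
    simp only [Finset.coe_product, Set.mem_prod, Finset.mem_coe, Equiv.Perm.mem_support,
      Finset.mem_compl, not_not] at hij
    obtain ⟨hi, hj⟩ := hij
    have hne : i ≠ j := fun h => hi (h ▸ hj)
    simp only [Finset.coe_map, Set.mem_image, Finset.mem_coe, Equiv.Perm.mem_support]
    refine ⟨⟨s(i, j), by simpa using hne⟩, fun h => ?_, rfl⟩
    have := congrArg Subtype.val h
    rw [pairPerm_coe, Sym2.map_mk, hj, Sym2.eq_iff] at this
    rcases this with h | h
    · exact hi h.1
    · exact hne h.2.symm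
  · rintro ⟨i, j⟩ hij ⟨k, l⟩ hkl h
    simp only [Finset.coe_product, Set.mem_prod, Finset.mem_coe, Equiv.Perm.mem_support,
      Finset.mem_compl, not_not] at hij hkl
    simp only [Sym2.eq_iff] at h
    rcases h with ⟨rfl, rfl⟩ | ⟨rfl, rfl⟩
    · rfl
    · exact absurd hkl.2 hij.1

/-- The vertex pairs with at least one vertex in `S`. -/
def touching (S : Finset (Fin n)) : Finset (VertexPair n) :=
  Finset.univ.filter fun e => ∃ i ∈ S, i ∈ e.1

theorem card_mul_le_two_mul_card_touching (S : Finset (Fin n)) :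
    S.card * (n - 1) ≤ 2 * (touching S).card := by
  classical
  have h : S.card * (n - 1) = (S.sigma fun i => Finset.univ.erase i).card := by
    rw [Finset.card_sigma]
    simp
  rw [h, ← Finset.card_map (Function.Embedding.subtype _)]
  refine Finset.card_le_mul_card_image_of_maps_to
    (f := fun x : (_ : Fin n) × Fin n => s(x.1, x.2)) ?_ 2 ?_
  · rintro ⟨i, j⟩ hij
    simp only [Finset.mem_sigma, Finset.mem_erase, Finset.mem_univ, and_true] at hij
    simp only [Finset.mem_map, touching, Finset.mem_filter, Finset.mem_univ, true_and]
    exact ⟨⟨s(i, j), by simpa using hij.2.symm⟩, ⟨i, hij.1, by simp⟩, rfl⟩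
  · intro e _
    induction e using Sym2.ind with
    | _ u v =>
      refine (Finset.card_le_card (t := {⟨u, v⟩, ⟨v, u⟩}) ?_).trans Finset.card_le_two
      rintro ⟨i, j⟩ hij
      rw [Finset.mem_filter] at hij
      rw [Finset.mem_insert, Finset.mem_singleton]
      rcases Sym2.eq_iff.1 hij.2 with ⟨h1, h2⟩ | ⟨h1, h2⟩
      · exact Or.inl (by simp_all)
      · exact Or.inr (by simp_all)

/-- A fixed pair containing a moved vertex i also contains σ i, hence is {i, σ i}: at most one
exceptional pair per moved vertex. -/
theorem card_touching_sdiff_le (σ : Equiv.Perm (Fin n)) :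
    (touching σ.support \ (pairPerm σ).support).card ≤ σ.support.card := by
  classical
  rw [← Finset.card_map (Function.Embedding.subtype _)]
  refine (Finset.card_le_card (t := σ.support.image fun i => s(i, σ i)) ?_).trans
    Finset.card_image_le
  intro e he
  simp only [Finset.mem_map, Finset.mem_sdiff, touching, Finset.mem_filter, Finset.mem_univ,
    true_and, Equiv.Perm.mem_support, not_not] at he
  obtain ⟨e, ⟨⟨i, hi, hie⟩, hfix⟩, rfl⟩ := he
  rw [Finset.mem_image]
  refine ⟨i, Equiv.Perm.mem_support.2 hi, ?_⟩
  have h1 := congrArg Subtype.val hfix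
  rw [pairPerm_coe] at h1
  have h2 : σ i ∈ e.1 := by
    rw [← h1]
    exact Sym2.mem_map.2 ⟨i, hie, rfl⟩
  exact ((Sym2.mem_and_mem_iff (Ne.symm hi)).1 ⟨hie, h2⟩).symm

theorem overlapOn_touching_le (σ : Equiv.Perm (Fin n)) (a b : VertexPair n → Bool) :
    overlapOn (touching σ.support) a b ≤
      overlapOn (pairPerm σ).support a b + σ.support.card := by
  classical
  refine le_trans ?_ (Nat.add_le_add_left (card_touching_sdiff_le σ) _)
  refine le_trans (Finset.card_le_card ?_) (Finset.card_union_le _ _)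
  intro e he
  simp only [Finset.mem_filter, Finset.mem_union, Finset.mem_sdiff] at he ⊢
  tauto

end Counting

/-! ### Achievability: the maximum overlap estimator. -/

section Achievability

/-- The maximum overlap estimator succeeds unless some nontrivial permutation does not decrease
the overlap of the two graphs. -/
theorem exists_estimator (n : ℕ) : ∃ est : Estimator n, ∀ p : EdgeProbs,
    1 - eventProb p (fun a b : VertexPair n → Bool => ∃ σ : Equiv.Perm (Fin n), σ ≠ 1 ∧
      overlapOn Finset.univ a b ≤ overlapOn Finset.univ (a ∘ pairPerm σ) b) ≤
      successProb p est := by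
  have hmax : ∀ gc gb : SimpleGraph (Fin n), ∃ π : Equiv.Perm (Fin n),
      ∀ τ : Equiv.Perm (Fin n),
        overlapOn Finset.univ (edgeIndicator gc ∘ pairPerm τ) (edgeIndicator gb) ≤
        overlapOn Finset.univ (edgeIndicator gc ∘ pairPerm π) (edgeIndicator gb) :=
    fun gc gb => Finite.exists_max _
  choose est hest using hmax
  refine ⟨est, fun p => ?_⟩
  rw [successProb_eq_sum, ← eventProb_not, le_div_iff₀ (by positivity)]
  have hcard : ((n.factorial : ℕ) : ℝ) = ∑ _σ : Equiv.Perm (Fin n), (1 : ℝ) := by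
    rw [Finset.sum_const, Finset.card_univ, Fintype.card_perm, Fintype.card_fin]
    simp
  rw [hcard, Finset.mul_sum]
  refine Finset.sum_le_sum fun σ _ => ?_
  rw [mul_one]
  refine eventProb_mono p fun a b hab => ?_
  by_contra hne
  set π := est (graphOf (a ∘ pairPerm σ⁻¹)) (graphOf b) with hπ
  -- Relative to the true labelling, the wrong guess π acts as σ⁻¹π, while σ itself recovers a.
  refine hab ⟨σ⁻¹ * π, fun h => hne ((inv_mul_eq_one.1 h).symm), ?_⟩
  have h := hest (graphOf (a ∘ pairPerm σ⁻¹)) (graphOf b) σ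
  rw [← hπ, edgeIndicator_graphOf, edgeIndicator_graphOf, Function.comp_assoc,
    Function.comp_assoc, ← Equiv.Perm.coe_mul, ← Equiv.Perm.coe_mul, ← pairPerm_mul,
    ← pairPerm_mul, inv_mul_cancel, pairPerm_one] at h
  exact h

/-- The choice x = L balances the two cross terms: p₀₀p₁₁y/L is at most p₁₁y/L, and p₀₁p₁₀L is at
most C p₁₁/L by `h3`. All corrections to 1 - 2p₁₁ are thus of order p₁₁/L. -/
theorem trace_transfer_sq_le (p : EdgeProbs) {L C y : ℝ} (hL : 1 ≤ L) (hC : 1 ≤ C) (hy : 1 ≤ y)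
    (h1 : p.p11 * L ≤ C) (h2 : (p.p01 + p.p10) * L ≤ C)
    (h3 : p.p01 * p.p10 * L ^ 2 ≤ C * p.p11) :
    ((transfer p L y) ^ 2).trace ≤ 1 - 2 * (p.p11 * (1 - 5 * C * y ^ 2 / L)) := by
  have hL0 : 0 < L := by linarith
  rw [trace_transfer_sq p hL0.ne']
  have h11 := p.p11_nonneg
  have h10 := p.p10_nonneg
  have h01 := p.p01_nonneg
  have h00 := p.p00_nonneg
  have hsum := p.sum_eq_one
  have ha : p.p11 * y * (p.p11 + p.p01 + p.p10) * L ≤ p.p11 * y * (2 * C) := by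
    have : (p.p11 + p.p01 + p.p10) * L ≤ 2 * C := by linarith
    rw [mul_assoc]
    gcongr
  have hb : p.p11 ^ 2 * (y - 1) ^ 2 * L ≤ p.p11 * C * y ^ 2 := by
    have hy2 : (y - 1) ^ 2 ≤ y ^ 2 := by nlinarith
    calc p.p11 ^ 2 * (y - 1) ^ 2 * L = p.p11 * (p.p11 * L) * (y - 1) ^ 2 := by ring
      _ ≤ p.p11 * C * y ^ 2 := by gcongr
  have hc : p.p00 * p.p11 * y ≤ p.p11 * y := by
    have : p.p00 ≤ 1 := by linarith
    have := mul_nonneg h11 (show (0 : ℝ) ≤ y by linarith)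
    nlinarith
  have hd : p.p01 * p.p10 * (L - 1) * L ≤ C * p.p11 := by
    have := mul_nonneg (mul_nonneg h01 h10) hL0.le
    nlinarith
  have hCy : 4 * C * y + C * y ^ 2 + 2 * y + 2 * C ≤ 10 * C * y ^ 2 := by
    have e1 : C * y ≤ C * y ^ 2 := by gcongr; nlinarith
    have e2 : C ≤ C * y := by nlinarith
    have e3 : y ≤ C * y := by nlinarith
    linarith
  have hCy' := mul_le_mul_of_nonneg_left hCy h11
  have hid : ((p.p00 + p.p01) ^ 2 + (p.p10 + p.p11 * y) ^ 2 +
      2 * ((p.p00 + p.p01 * L) * (p.p10 + p.p11 * (y / L)))) * L =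
      L - 2 * p.p11 * L + 2 * (p.p11 * y * (p.p11 + p.p01 + p.p10) * L) +
      p.p11 ^ 2 * (y - 1) ^ 2 * L + 2 * (p.p00 * p.p11 * y) +
      2 * (p.p01 * p.p10 * (L - 1) * L) := by
    have : p.p00 = 1 - p.p11 - p.p10 - p.p01 := by linarith
    rw [this]
    field_simp
    ring
  rw [← mul_le_mul_iff_left₀ hL0, hid]
  have hrhs : (1 - 2 * (p.p11 * (1 - 5 * C * y ^ 2 / L))) * L =
      L - 2 * p.p11 * L + p.p11 * (10 * C * y ^ 2) := by
    field_simp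
    ring
  rw [hrhs]
  nlinarith

/-- The probability that some permutation moving few vertices does not decrease the overlap. -/
theorem sum_small_support_le (p : EdgeProbs) {n : ℕ} {C w : ℝ} (hn : 1 ≤ n) (hC : 1 ≤ C)
    (hw : 0 ≤ w) (hlog : 2 * (5 * C + 16) ≤ Real.log n)
    (h0 : Real.log n + w ≤ p.p11 * n) (h1 : p.p11 * Real.log n ≤ C)
    (h2 : (p.p01 + p.p10) * Real.log n ≤ C)
    (h3 : p.p01 * p.p10 * Real.log n ^ 2 ≤ C * p.p11)
    (hu : Real.exp (5 * C + 16 - w / 2) ≤ 1 / 2) :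
    ∑ σ : Equiv.Perm (Fin n) with σ ≠ 1 ∧ σ.support.card * Real.log n ≤ 16 * n,
      eventProb p (fun a b => overlapOn Finset.univ a b ≤
        overlapOn Finset.univ (a ∘ pairPerm σ) b) ≤ 2 * Real.exp (5 * C + 16 - w / 2) := by
  set L := Real.log n with hLdef
  have hL0 : 0 < L := by linarith
  have hn0 : (0 : ℝ) < n := by exact_mod_cast hn
  refine sum_perm_le _ (by simp) (Real.exp_pos _).le hu fun σ hσ => ?_
  rw [Finset.mem_filter] at hσ
  obtain ⟨-, -, hk⟩ := hσ
  set k := σ.support.card with hkdef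
  have hkn : k ≤ n := by simpa using Finset.card_le_univ σ.support
  have hfrac : 0 ≤ 1 - 5 * C / L := by
    rw [sub_nonneg, div_le_one hL0]
    linarith
  set s := Real.exp (-(p.p11 * (1 - 5 * C / L))) with hs
  have hs1 : s ≤ 1 := Real.exp_le_one_iff.2 (neg_nonpos.2 (mul_nonneg p.p11_nonneg hfrac))
  have hq : ((transfer p L (Real.exp 0)) ^ 2).trace ≤ s ^ 2 := by
    rw [Real.exp_zero]
    refine (trace_transfer_sq_le p (by linarith) hC le_rfl h1 h2 h3).trans ?_
    rw [one_pow, mul_one, hs, ← Real.exp_nat_mul]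
    have := Real.add_one_le_exp (-(2 * (p.p11 * (1 - 5 * C / L))))
    push_cast
    rw [mul_neg]
    linarith
  have hP := eventProb_overlapOn_le p (pairPerm σ) (x := L) (t := 0) (s := s) 0 (by linarith) le_rfl
    (Real.exp_pos _).le hq
  rw [zero_mul, neg_zero, Real.exp_zero, one_mul] at hP
  have hP' : eventProb p (fun a b => overlapOn Finset.univ a b ≤
      overlapOn Finset.univ (a ∘ pairPerm σ) b) ≤ s ^ (k * (n - k)) :=
    ((eventProb_mono p fun a b h => ⟨h, Nat.cast_nonneg _⟩).trans hP).trans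
      (pow_le_pow_of_le_one (Real.exp_pos _).le hs1 (mul_sub_le_card_support_pairPerm σ))
  -- Since k ≤ 16n/L, the relative losses 5C/L and 16/L together cost 5C + 16 against the main term
  -- L; as (5C + 16)/L ≤ 1/2, at least half of w survives.
  have hexp : L - p.p11 * (1 - 5 * C / L) * (n - k) ≤ 5 * C + 16 - w / 2 := by
    have hk' : (n : ℝ) * (1 - 16 / L) ≤ n - k := by
      have : (k : ℝ) ≤ 16 * n / L := (le_div_iff₀ hL0).2 hk
      have h : (n : ℝ) * (1 - 16 / L) = n - 16 * n / L := by ring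
      rw [h]
      linarith
    have hf2 : 0 ≤ 1 - 16 / L := by
      rw [sub_nonneg, div_le_one hL0]
      linarith
    have e1 : 1 - (5 * C + 16) / L ≤ (1 - 5 * C / L) * (1 - 16 / L) := by
      have : 0 ≤ 5 * C / L * (16 / L) := by positivity
      have h : (5 * C + 16) / L = 5 * C / L + 16 / L := add_div _ _ _
      rw [h]
      nlinarith
    have e2 : L + w / 2 - (5 * C + 16) ≤ (L + w) * (1 - (5 * C + 16) / L) := by
      have : w * ((5 * C + 16) / L) ≤ w * (1 / 2) :=
        mul_le_mul_of_nonneg_left ((div_le_iff₀ hL0).2 (by linarith)) hw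
      have h : (L + w) * (1 - (5 * C + 16) / L) =
          L + w - (5 * C + 16) - w * ((5 * C + 16) / L) := by
        field_simp
        ring
      rw [h]
      linarith
    have e3 : (L + w) * (1 - (5 * C + 16) / L) ≤
        p.p11 * (1 - 5 * C / L) * (n - k) := by
      calc (L + w) * (1 - (5 * C + 16) / L)
          ≤ (L + w) * ((1 - 5 * C / L) * (1 - 16 / L)) := by gcongr
        _ ≤ (p.p11 * n) * ((1 - 5 * C / L) * (1 - 16 / L)) := by gcongr
        _ = p.p11 * (1 - 5 * C / L) * (n * (1 - 16 / L)) := by ring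
        _ ≤ _ := by
          have := mul_nonneg p.p11_nonneg hfrac
          gcongr
    linarith
  have hnk : (n : ℝ) ^ k = Real.exp (k * L) := by
    rw [Real.exp_nat_mul, Real.exp_log hn0]
  calc _ ≤ s ^ (k * (n - k)) * (n : ℝ) ^ k := by gcongr
    _ = Real.exp (k * (L - p.p11 * (1 - 5 * C / L) * (n - k))) := by
      rw [hnk, hs, ← Real.exp_nat_mul, ← Real.exp_add, Nat.cast_mul, Nat.cast_sub hkn]
      congr 1
      ring
    _ ≤ Real.exp (k * (5 * C + 16 - w / 2)) := by gcongr
    _ = _ := Real.exp_nat_mul _ _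

/-- The probability that some large vertex set touches few common edges. -/
theorem eventProb_exists_overlapOn_touching_lt_le (p : EdgeProbs) {n : ℕ} (hn : 4 ≤ n)
    (h0 : Real.log n ≤ p.p11 * n) :
    eventProb p (fun a b : VertexPair n → Bool => ∃ S ∈ Finset.univ.filter
      (fun S : Finset (Fin n) => 16 * (n : ℝ) ≤ S.card * Real.log n),
      (overlapOn (touching S) a b : ℝ) < p.p11 * S.card * n / 8) ≤
      (2 * Real.exp (-1)) ^ n := by
  refine (eventProb_exists_le p _ _).trans ?_
  have hterm : ∀ S ∈ Finset.univ.filter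
      (fun S : Finset (Fin n) => 16 * (n : ℝ) ≤ S.card * Real.log n),
      eventProb p (fun a b => (overlapOn (touching S) a b : ℝ) < p.p11 * S.card * n / 8) ≤
        Real.exp (-1) ^ n := by
    intro S hS
    have hS' := (Finset.mem_filter.1 hS).2
    refine (eventProb_overlapOn_lt_le p (touching S) _).trans ?_
    rw [← Real.exp_nat_mul]
    refine Real.exp_le_exp.2 ?_
    have hcard : (S.card : ℝ) * (n - 1) ≤ 2 * (touching S).card := by
      have := card_mul_le_two_mul_card_touching S
      have h : ((S.card * (n - 1) : ℕ) : ℝ) ≤ ((2 * (touching S).card : ℕ) : ℝ) := by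
        exact_mod_cast this
      rw [Nat.cast_mul, Nat.cast_mul, Nat.cast_sub (by omega)] at h
      simpa using h
    have hn4 : (4 : ℝ) ≤ n := by exact_mod_cast hn
    have hp := mul_le_mul_of_nonneg_left hcard p.p11_nonneg
    have hk := mul_le_mul_of_nonneg_left h0 (Nat.cast_nonneg S.card : (0 : ℝ) ≤ S.card)
    have hpk : 0 ≤ p.p11 * S.card := mul_nonneg p.p11_nonneg (Nat.cast_nonneg _)
    -- As |touching S| ≥ |S|(n-1)/2 and n ≥ 4, the exponent is at most -p₁₁|S|n/16 ≤ -|S| log n/16 ≤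
    -- -n, which beats the 2^n choices of S.
    nlinarith
  refine (Finset.sum_le_sum hterm).trans ?_
  rw [Finset.sum_const, nsmul_eq_mul, mul_pow]
  gcongr
  have := Finset.card_le_univ (Finset.univ.filter
      (fun S : Finset (Fin n) => 16 * (n : ℝ) ≤ S.card * Real.log n))
  rw [Fintype.card_finset, Fintype.card_fin] at this
  exact_mod_cast this

/-- The probability that some permutation moving many vertices does not decrease the overlap,
although the moved vertices touch many common edges. -/
theorem sum_large_support_le (p : EdgeProbs) {n : ℕ} {C : ℝ} (hn : 2 ≤ n) (hC : 1 ≤ C)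
    (hlog : 5 * C * Real.exp 32 ^ 2 ≤ Real.log n) (hlog' : 16 ≤ Real.log n)
    (h0 : Real.log n ≤ p.p11 * n) (h1 : p.p11 * Real.log n ≤ C)
    (h2 : (p.p01 + p.p10) * Real.log n ≤ C)
    (h3 : p.p01 * p.p10 * Real.log n ^ 2 ≤ C * p.p11) :
    ∑ σ : Equiv.Perm (Fin n) with σ ≠ 1, eventProb p (fun a b =>
      overlapOn Finset.univ a b ≤ overlapOn Finset.univ (a ∘ pairPerm σ) b ∧
      p.p11 * σ.support.card * n / 8 ≤ overlapOn (touching σ.support) a b) ≤ 2 * (1 / n) := by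
  set L := Real.log n with hLdef
  have hL0 : 0 < L := by linarith
  have hn2 : (2 : ℝ) ≤ n := by exact_mod_cast hn
  have hn0 : (0 : ℝ) < n := by linarith
  refine sum_perm_le _ (by simp) (by positivity) (one_div_le_one_div_of_le two_pos hn2)
    fun σ _ => ?_
  set k := σ.support.card with hkdef
  -- For large n the tilt y = e^32 still keeps the trace below 1, so s = 1 suffices and all decay
  -- comes from exp(-tm).
  have hq : ((transfer p L (Real.exp 32)) ^ 2).trace ≤ 1 ^ 2 := by
    refine (trace_transfer_sq_le p (by linarith) hC (Real.one_le_exp (by norm_num)) h1 h2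
      h3).trans ?_
    have : 0 ≤ 1 - 5 * C * Real.exp 32 ^ 2 / L := by
      rw [sub_nonneg, div_le_one hL0]
      exact hlog
    have := mul_nonneg p.p11_nonneg this
    linarith
  have hP := eventProb_overlapOn_le p (pairPerm σ) (x := L) (t := 32) (s := 1)
    (p.p11 * k * n / 16) (by linarith) (by norm_num) zero_le_one hq
  rw [one_pow, mul_one] at hP
  have hpk : k * L ≤ p.p11 * k * n := by
    have := mul_le_mul_of_nonneg_left h0 (Nat.cast_nonneg k : (0 : ℝ) ≤ k)
    linarith
  have hmono : eventProb p (fun a b =>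
      overlapOn Finset.univ a b ≤ overlapOn Finset.univ (a ∘ pairPerm σ) b ∧
      p.p11 * k * n / 8 ≤ overlapOn (touching σ.support) a b) ≤
      Real.exp (-(32 * (p.p11 * k * n / 16))) := by
    -- Passing from touched to moved pairs loses at most k ≤ kL/16 ≤ p₁₁kn/16 common edges, half of
    -- the assumed p₁₁kn/8.
    refine (eventProb_mono p fun a b h => ⟨h.1, ?_⟩).trans hP
    have hov : (overlapOn (touching σ.support) a b : ℝ) ≤
        overlapOn (pairPerm σ).support a b + k := by
      exact_mod_cast overlapOn_touching_le σ a b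
    have := h.2
    have : (k : ℝ) * 16 ≤ k * L := by gcongr
    linarith
  have hnk : (n : ℝ) ^ k = Real.exp (k * L) := by
    rw [Real.exp_nat_mul, Real.exp_log hn0]
  rw [one_div, inv_pow, hnk, ← Real.exp_neg]
  -- The exponent is -2p₁₁kn ≤ -2kL; the count n^k = exp(kL) uses half of it.
  calc _ ≤ Real.exp (-(32 * (p.p11 * k * n / 16))) * Real.exp (k * L) := by gcongr
    _ = Real.exp (-(32 * (p.p11 * k * n / 16)) + k * L) := (Real.exp_add _ _).symm
    _ ≤ _ := Real.exp_le_exp.2 (by linarith)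

theorem eventProb_exists_perm_le (p : EdgeProbs) {n : ℕ} {C w : ℝ} (hn : 4 ≤ n) (hC : 1 ≤ C)
    (hw : 0 ≤ w) (hlog : 2 * (5 * C + 16) ≤ Real.log n)
    (hlog' : 5 * C * Real.exp 32 ^ 2 ≤ Real.log n)
    (h0 : Real.log n + w ≤ p.p11 * n) (h1 : p.p11 * Real.log n ≤ C)
    (h2 : (p.p01 + p.p10) * Real.log n ≤ C)
    (h3 : p.p01 * p.p10 * Real.log n ^ 2 ≤ C * p.p11)
    (hu : Real.exp (5 * C + 16 - w / 2) ≤ 1 / 2) :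
    eventProb p (fun a b : VertexPair n → Bool => ∃ σ : Equiv.Perm (Fin n), σ ≠ 1 ∧
      overlapOn Finset.univ a b ≤ overlapOn Finset.univ (a ∘ pairPerm σ) b) ≤
      2 * Real.exp (5 * C + 16 - w / 2) + ((2 * Real.exp (-1)) ^ n + 2 * (1 / n)) := by
  have hlog16 : 16 ≤ Real.log n := by linarith
  have h0' : Real.log n ≤ p.p11 * n := by linarith
  refine le_trans ?_ (add_le_add (sum_small_support_le p (by omega) hC hw hlog h0 h1 h2 h3 hu)
    (add_le_add (eventProb_exists_overlapOn_touching_lt_le p hn h0')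
      (sum_large_support_le p (by omega) hC hlog' hlog16 h0' h1 h2 h3)))
  refine le_trans ?_ (add_le_add (eventProb_exists_le p _ _)
    (add_le_add_right (eventProb_exists_le p _ _) _))
  refine le_trans ?_ (add_le_add_right (eventProb_or_le p _ _) _)
  refine le_trans ?_ (eventProb_or_le p _ _)
  refine eventProb_mono p ?_
  rintro a b ⟨σ, hσ, hov⟩
  by_cases hk : σ.support.card * Real.log n ≤ 16 * n
  · exact Or.inl ⟨σ, by simp [hσ, hk], hov⟩
  · by_cases hS : (overlapOn (touching σ.support) a b : ℝ) < p.p11 * σ.support.card * n / 8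
    · exact Or.inr (Or.inl ⟨σ.support, by simpa using (not_le.1 hk).le, hS⟩)
    · exact Or.inr (Or.inr ⟨σ, by simp [hσ], hov, not_lt.1 hS⟩)

theorem achievability (p : ℕ → EdgeProbs) (w : ℕ → ℝ) (hw : Tendsto w atTop atTop)
    (h0 : ∀ᶠ n : ℕ in atTop, (Real.log n + w n) / n ≤ (p n).p11)
    (h1 : (fun n : ℕ => (p n).p11) =O[atTop] fun n : ℕ => 1 / Real.log n)
    (h2 : (fun n : ℕ => (p n).p01 + (p n).p10) =O[atTop] fun n : ℕ => 1 / Real.log n)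
    (h3 : (fun n : ℕ => ((p n).p01 * (p n).p10) / ((p n).p11 * (p n).p00)) =O[atTop]
      fun n : ℕ => 1 / (Real.log n) ^ 3) :
    ∃ est : (n : ℕ) → Estimator n,
      Tendsto (fun n => successProb (p n) (est n)) atTop (𝓝 1) := by
  choose est hest using exists_estimator
  refine ⟨est, ?_⟩
  obtain ⟨C1, hC1⟩ := h1.bound
  obtain ⟨C2, hC2⟩ := h2.bound
  obtain ⟨C3, hC3⟩ := h3.bound
  obtain ⟨C, hC, hCC1, hCC2, hCC3⟩ : ∃ C : ℝ, 1 ≤ C ∧ C1 ≤ C ∧ C2 ≤ C ∧ C3 ≤ C :=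
    ⟨max 1 (max C1 (max C2 C3)), by simp, by simp, by simp, by simp⟩
  have hlogT : Tendsto (fun n : ℕ => Real.log n) atTop atTop :=
    Real.tendsto_log_atTop.comp tendsto_natCast_atTop_atTop
  have hu : Tendsto (fun n => Real.exp (5 * C + 16 - w n / 2)) atTop (𝓝 0) := by
    refine Real.tendsto_exp_atBot.comp ?_
    simp only [sub_eq_add_neg]
    exact tendsto_atBot_add_const_left _ _ (tendsto_neg_atTop_atBot.comp
      (hw.atTop_div_const two_pos))
  have hlim : Tendsto (fun n : ℕ => 1 - (2 * Real.exp (5 * C + 16 - w n / 2) +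
      ((2 * Real.exp (-1)) ^ n + 2 * (1 / (n : ℝ))))) atTop (𝓝 1) := by
    have hpow : Tendsto (fun n : ℕ => (2 * Real.exp (-1)) ^ n) atTop (𝓝 0) := by
      refine tendsto_pow_atTop_nhds_zero_of_lt_one (by positivity) ?_
      have := Real.exp_neg_one_lt_d9
      linarith
    have := (hu.const_mul 2).add (hpow.add ((tendsto_one_div_atTop_nhds_zero_nat (𝕜 := ℝ)).const_mul 2))
    simpa using this.const_sub 1
  refine tendsto_of_tendsto_of_tendsto_of_le_of_le' hlim tendsto_const_nhds ?_ ?_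
  · filter_upwards [h0, hC1, hC2, hC3, hw.eventually_ge_atTop 0,
      hlogT.eventually_ge_atTop (2 * (5 * C + 16)),
      hlogT.eventually_ge_atTop (5 * C * Real.exp 32 ^ 2), eventually_ge_atTop 4,
      hu.eventually_le_const (show (0 : ℝ) < 1 / 2 by norm_num)]
      with n e0 e1 e2 e3 ew eL eL' en eu
    refine le_trans ?_ (hest n (p n))
    have hL0 : 0 < Real.log n := by linarith
    have hn0 : (0 : ℝ) < n := by exact_mod_cast (by omega : 0 < n)
    have a11 := (p n).p11_nonneg
    have a10 := (p n).p10_nonneg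
    have a01 := (p n).p01_nonneg
    have a00 := (p n).p00_nonneg
    have asum := (p n).sum_eq_one
    have f0 : Real.log n + w n ≤ (p n).p11 * n := (div_le_iff₀ hn0).1 e0
    have f1 : (p n).p11 * Real.log n ≤ C := by
      rw [Real.norm_of_nonneg a11, Real.norm_of_nonneg (by positivity)] at e1
      have := e1.trans (mul_le_mul_of_nonneg_right hCC1 (by positivity))
      rwa [mul_one_div, le_div_iff₀ hL0] at this
    have f2 : ((p n).p01 + (p n).p10) * Real.log n ≤ C := by
      rw [Real.norm_of_nonneg (add_nonneg a01 a10), Real.norm_of_nonneg (by positivity)] at e2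
      have := e2.trans (mul_le_mul_of_nonneg_right hCC2 (by positivity))
      rwa [mul_one_div, le_div_iff₀ hL0] at this
    have f3 : (p n).p01 * (p n).p10 * Real.log n ^ 2 ≤ C * (p n).p11 := by
      -- Positivity of p₁₁ and p₀₀ excludes the value 0 of a quotient with zero denominator. If p₀₀
      -- = 0, the other three probabilities sum to 1, contradicting their O(1/log n) bounds.
      have b11 : 0 < (p n).p11 := by
        have : 0 < (p n).p11 * n := by linarith
        exact pos_of_mul_pos_left this hn0.le
      have b00 : 0 < (p n).p00 := by
        by_contra h
        have : (p n).p00 = 0 := le_antisymm (not_lt.1 h) a00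
        have : 1 * Real.log n ≤ 2 * C := by
          rw [← asum, this]
          linarith
        linarith
      rw [Real.norm_of_nonneg (by positivity), Real.norm_of_nonneg (by positivity)] at e3
      have := e3.trans (mul_le_mul_of_nonneg_right hCC3 (by positivity))
      rw [mul_one_div, div_le_div_iff₀ (by positivity) (by positivity)] at this
      have hle : (p n).p01 * (p n).p10 * Real.log n ^ 2 ≤
          (p n).p01 * (p n).p10 * Real.log n ^ 3 := by
        have : Real.log n ^ 2 ≤ Real.log n ^ 3 :=
          pow_le_pow_right₀ (by linarith) (by norm_num)
        gcongr
      have h00 : (p n).p00 ≤ 1 := by linarith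
      have : C * ((p n).p11 * (p n).p00) ≤ C * ((p n).p11 * 1) := by gcongr
      linarith
    have := eventProb_exists_perm_le (p n) en hC ew eL eL' f0 f1 f2 f3 eu
    linarith
  · refine Eventually.of_forall fun n => ?_
    rw [successProb_eq_sum, div_le_one (by positivity)]
    refine (Finset.sum_le_sum fun σ _ => eventProb_le_one (p n) _).trans ?_
    rw [Finset.sum_const, Finset.card_univ, Fintype.card_perm, Fintype.card_fin]
    simp

end Achievability

/-! ### Converse: isolated vertices of the intersection graph. -/

section Converse

theorem weight_eq_prod_pow {V : Type} [Fintype V] (p : EdgeProbs) (a b : V → Bool) :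
    weight p a b = p.p11 ^ overlapOn Finset.univ a b *
      p.p10 ^ overlapOn Finset.univ a (fun e => !b e) *
      p.p01 ^ overlapOn Finset.univ (fun e => !a e) b *
      p.p00 ^ overlapOn Finset.univ (fun e => !a e) (fun e => !b e) := by
  simp only [overlapOn, ← Finset.prod_const, Finset.prod_filter]
  rw [weight, ← Finset.prod_mul_distrib, ← Finset.prod_mul_distrib, ← Finset.prod_mul_distrib]
  refine Finset.prod_congr rfl fun e _ => ?_
  cases a e <;> cases b e <;> simp [EdgeProbs.prob]

theorem overlapOn_add_overlapOn_not {V : Type} [Fintype V] (a b : V → Bool) :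
    overlapOn Finset.univ a b + overlapOn Finset.univ a (fun e => !b e) =
      ∑ e, if a e = true then 1 else 0 := by
  rw [overlapOn_eq_sum, overlapOn_eq_sum, ← Finset.sum_add_distrib]
  refine Finset.sum_congr rfl fun e _ => ?_
  cases a e <;> cases b e <;> simp

theorem overlapOn_add_not_overlapOn {V : Type} [Fintype V] (a b : V → Bool) :
    overlapOn Finset.univ a b + overlapOn Finset.univ (fun e => !a e) b =
      ∑ e, if b e = true then 1 else 0 := by
  rw [overlapOn_eq_sum, overlapOn_eq_sum, ← Finset.sum_add_distrib]
  refine Finset.sum_congr rfl fun e _ => ?_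
  cases a e <;> cases b e <;> simp

/-- Under positive correlation, relabelling `a` so as to increase the overlap with `b` increases
the likelihood. -/
theorem weight_le_weight_comp {V : Type} [Fintype V] (p : EdgeProbs)
    (hp : p.p01 * p.p10 ≤ p.p11 * p.p00) (a b : V → Bool) (τ : Equiv.Perm V)
    (h : overlapOn Finset.univ a b ≤ overlapOn Finset.univ (a ∘ τ) b) :
    weight p a b ≤ weight p (a ∘ τ) b := by
  have hsum : ∑ e, (if (a ∘ τ) e = true then 1 else 0) = ∑ e, if a e = true then 1 else 0 :=
    Equiv.sum_comp τ fun e => if a e = true then 1 else 0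
  have hsum' : ∑ e, (if (!(a ∘ τ) e) = true then 1 else 0) =
      ∑ e, if (!a e) = true then 1 else 0 :=
    Equiv.sum_comp τ fun e => if (!a e) = true then 1 else 0
  have h1 := overlapOn_add_overlapOn_not a b
  have h2 := overlapOn_add_overlapOn_not (a ∘ τ) b
  have h3 := overlapOn_add_not_overlapOn a b
  have h4 := overlapOn_add_not_overlapOn (a ∘ τ) b
  have h5 := overlapOn_add_overlapOn_not (fun e => !a e) b
  have h6 := overlapOn_add_overlapOn_not (fun e => !(a ∘ τ) e) b
  rw [hsum] at h2
  rw [hsum'] at h6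
  rw [weight_eq_prod_pow, weight_eq_prod_pow]
  -- Relabelling preserves the edge counts of a and b, so d extra common edges trade d labels each
  -- of types 10 and 01 for d each of types 11 and 00.
  obtain ⟨d, hd⟩ := Nat.exists_eq_add_of_le h
  have e10 : overlapOn Finset.univ a (fun e => !b e) =
      overlapOn Finset.univ (a ∘ τ) (fun e => !b e) + d := by omega
  have e01 : overlapOn Finset.univ (fun e => !a e) b =
      overlapOn Finset.univ (fun e => !(a ∘ τ) e) b + d := by omega
  have e00 : overlapOn Finset.univ (fun e => !(a ∘ τ) e) (fun e => !b e) =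
      overlapOn Finset.univ (fun e => !a e) (fun e => !b e) + d := by omega
  rw [hd, e10, e01, e00]
  simp only [pow_add]
  have hpow : (p.p01 * p.p10) ^ d ≤ (p.p11 * p.p00) ^ d :=
    pow_le_pow_left₀ (mul_nonneg p.p01_nonneg p.p10_nonneg) hp d
  rw [mul_pow, mul_pow] at hpow
  have hA : 0 ≤ p.p11 ^ overlapOn Finset.univ a b *
      p.p10 ^ overlapOn Finset.univ (a ∘ τ) (fun e => !b e) *
      p.p01 ^ overlapOn Finset.univ (fun e => !(a ∘ τ) e) b *
      p.p00 ^ overlapOn Finset.univ (fun e => !a e) (fun e => !b e) :=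
    mul_nonneg (mul_nonneg (mul_nonneg (pow_nonneg p.p11_nonneg _) (pow_nonneg p.p10_nonneg _))
      (pow_nonneg p.p01_nonneg _)) (pow_nonneg p.p00_nonneg _)
  have := mul_le_mul_of_nonneg_left hpow hA
  linarith

variable {n : ℕ}

open Classical in
/-- The vertices that are isolated in the intersection of the graphs. -/
noncomputable def isolated (a b : VertexPair n → Bool) : Finset (Fin n) :=
  Finset.univ.filter fun i => ∀ e : VertexPair n, i ∈ e.1 → ¬ (a e = true ∧ b e = true)

theorem mem_isolated {a b : VertexPair n → Bool} {i : Fin n} :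
    i ∈ isolated a b ↔ ∀ e : VertexPair n, i ∈ e.1 → ¬ (a e = true ∧ b e = true) := by
  simp [isolated]

/-- A common edge contains neither i nor j, so the transposition fixes it. -/
theorem overlapOn_le_of_isolated {a b : VertexPair n → Bool} {i j : Fin n}
    (hi : i ∈ isolated a b) (hj : j ∈ isolated a b) :
    overlapOn Finset.univ a b ≤ overlapOn Finset.univ (a ∘ pairPerm (Equiv.swap i j)) b := by
  refine Finset.card_le_card fun e he => ?_
  simp only [Finset.mem_filter, Finset.mem_univ, true_and] at he ⊢
  have hfix : pairPerm (Equiv.swap i j) e = e := by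
    apply Subtype.ext
    rw [pairPerm_coe]
    refine (Sym2.map_congr (g := id) fun v hv => ?_).trans (by rw [Sym2.map_id, id_eq])
    refine Equiv.swap_apply_of_ne_of_ne ?_ ?_
    · rintro rfl
      exact mem_isolated.1 hi e hv he
    · rintro rfl
      exact mem_isolated.1 hj e hv he
  rwa [Function.comp_apply, hfix]

/-- Fix one isolated i; the transpositions (i j) with j isolated are distinct (j = i giving the
identity), and none lowers the likelihood. -/
theorem card_isolated_mul_weight_le (p : EdgeProbs) (hp : p.p01 * p.p10 ≤ p.p11 * p.p00)
    (a b : VertexPair n → Bool) :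
    (isolated a b).card * weight p a b ≤
      ∑ σ : Equiv.Perm (Fin n), weight p (a ∘ pairPerm σ) b := by
  classical
  rcases (isolated a b).eq_empty_or_nonempty with h | ⟨i, hi⟩
  · rw [h]
    simpa using Finset.sum_nonneg fun σ _ => weight_nonneg p (a ∘ pairPerm σ) b
  have hinj : Set.InjOn (fun j => Equiv.swap i j) (isolated a b : Set (Fin n)) := by
    intro j _ k _ hjk
    have := congrArg (fun σ : Equiv.Perm (Fin n) => σ i) hjk
    simpa using this
  calc ((isolated a b).card : ℝ) * weight p a b = ∑ j ∈ isolated a b, weight p a b := by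
        rw [Finset.sum_const, nsmul_eq_mul]
    _ ≤ ∑ j ∈ isolated a b, weight p (a ∘ pairPerm (Equiv.swap i j)) b :=
        Finset.sum_le_sum fun j hj =>
          weight_le_weight_comp p hp a b _ (overlapOn_le_of_isolated hi hj)
    _ = ∑ σ ∈ (isolated a b).image (fun j => Equiv.swap i j), weight p (a ∘ pairPerm σ) b := by
        rw [Finset.sum_image hinj]
    _ ≤ _ := Finset.sum_le_sum_of_subset_of_nonneg (Finset.subset_univ _)
        fun σ _ _ => weight_nonneg _ _ _

/-- Many isolated vertices in the intersection graph make every estimator fail. -/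
theorem successProb_le (p : EdgeProbs) (hp : p.p01 * p.p10 ≤ p.p11 * p.p00) (est : Estimator n)
    {M : ℝ} (hM : 0 < M) :
    successProb p est ≤ 1 / M + eventProb p (fun a b : VertexPair n → Bool =>
      ((isolated a b).card : ℝ) < M) := by
  classical
  set F : (VertexPair n → Bool) → (VertexPair n → Bool) → ℝ := fun a b =>
    weight p a b / M + if ((isolated a b).card : ℝ) < M then weight p a b else 0 with hF
  have hre : ∀ (σ : Equiv.Perm (Fin n)) (H : (VertexPair n → Bool) → ℝ),
      ∑ a, H a = ∑ c : VertexPair n → Bool, H (c ∘ pairPerm σ) := fun σ H =>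
    (Equiv.sum_comp ((pairPerm σ).symm.arrowCongr (Equiv.refl Bool)) H).symm
  have hFsum : ∑ a, ∑ b, F a b = 1 / M + eventProb p (fun a b : VertexPair n → Bool =>
      ((isolated a b).card : ℝ) < M) := by
    simp only [hF, Finset.sum_add_distrib]
    congr 1
    · simp only [← Finset.sum_div]
      rw [sum_sum_weight]
  have hF0 : ∀ a b, 0 ≤ F a b := fun a b => by
    have := weight_nonneg p a b
    simp only [hF]
    split_ifs <;> positivity
  -- Here c is the observed `G_c` and π any guess. Either the guessed labelling has few isolated
  -- vertices and is paid for by the second term of F, or its likelihood is at most a 1/M fraction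
  -- of the total over all labellings.
  have hkey : ∀ (c b : VertexPair n → Bool) (π : Equiv.Perm (Fin n)),
      weight p (c ∘ pairPerm π) b ≤ ∑ σ : Equiv.Perm (Fin n), F (c ∘ pairPerm σ) b := by
    intro c b π
    by_cases hX : ((isolated (c ∘ pairPerm π) b).card : ℝ) < M
    · refine le_trans ?_ (Finset.single_le_sum
        (f := fun σ : Equiv.Perm (Fin n) => F (c ∘ pairPerm σ) b) (fun σ _ => hF0 _ _)
        (Finset.mem_univ π))
      have := div_nonneg (weight_nonneg p (c ∘ pairPerm π) b) hM.le
      simp only [hF, if_pos hX]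
      linarith
    · have h1 := card_isolated_mul_weight_le p hp (c ∘ pairPerm π) b
      have h2 : ∑ σ : Equiv.Perm (Fin n), weight p ((c ∘ pairPerm π) ∘ pairPerm σ) b =
          ∑ σ : Equiv.Perm (Fin n), weight p (c ∘ pairPerm σ) b := by
        rw [← Equiv.sum_comp (Equiv.mulLeft π)
          (fun σ : Equiv.Perm (Fin n) => weight p (c ∘ pairPerm σ) b)]
        refine Finset.sum_congr rfl fun σ _ => ?_
        rw [Equiv.coe_mulLeft, pairPerm_mul]
        rfl
      rw [h2] at h1
      calc weight p (c ∘ pairPerm π) b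
          ≤ (∑ σ : Equiv.Perm (Fin n), weight p (c ∘ pairPerm σ) b) / M := by
            rw [le_div_iff₀ hM]
            refine le_trans ?_ h1
            rw [mul_comm]
            exact mul_le_mul_of_nonneg_right (not_lt.1 hX) (weight_nonneg _ _ _)
        _ = ∑ σ : Equiv.Perm (Fin n), weight p (c ∘ pairPerm σ) b / M := Finset.sum_div _ _ _
        _ ≤ _ := by
            refine Finset.sum_le_sum fun σ _ => ?_
            have := weight_nonneg p (c ∘ pairPerm σ) b
            simp only [hF]
            split_ifs <;> linarith
  rw [successProb_eq_sum, div_le_iff₀ (by positivity), ← hFsum]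
  calc _ = ∑ c : VertexPair n → Bool, ∑ b : VertexPair n → Bool,
        ∑ σ : Equiv.Perm (Fin n), if est (graphOf c) (graphOf b) = σ then
          weight p (c ∘ pairPerm σ) b else 0 := by
        rw [Finset.sum_congr rfl fun c _ => Finset.sum_comm, Finset.sum_comm]
        refine Finset.sum_congr rfl fun σ _ => ?_
        rw [eventProb, hre σ]
        refine Finset.sum_congr rfl fun c _ => Finset.sum_congr rfl fun b _ => ?_
        rw [Function.comp_assoc, ← Equiv.Perm.coe_mul, ← pairPerm_mul, mul_inv_cancel,
          pairPerm_one, Equiv.Perm.coe_one, Function.comp_id]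
        congr!
    _ ≤ ∑ c : VertexPair n → Bool, ∑ b : VertexPair n → Bool,
        ∑ σ : Equiv.Perm (Fin n), F (c ∘ pairPerm σ) b := by
        refine Finset.sum_le_sum fun c _ => Finset.sum_le_sum fun b _ => ?_
        rw [Finset.sum_ite_eq, if_pos (Finset.mem_univ _)]
        exact hkey c b _
    _ = ∑ _σ : Equiv.Perm (Fin n), ∑ a, ∑ b, F a b := by
        rw [Finset.sum_congr rfl fun c _ => Finset.sum_comm, Finset.sum_comm]
        exact Finset.sum_congr rfl fun σ _ => (hre σ fun a => ∑ b, F a b).symm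
    _ = _ := by
        rw [Finset.sum_const, Finset.card_univ, Fintype.card_perm, Fintype.card_fin,
          nsmul_eq_mul, mul_comm]

theorem card_touching_singleton (i : Fin n) : (touching {i}).card = n - 1 := by
  classical
  have h : n - 1 = (Finset.univ.erase i).card := by simp
  rw [h, ← Finset.card_map (Function.Embedding.subtype _)]
  refine (Finset.card_bij (fun j _ => s(i, j)) ?_ ?_ ?_).symm
  · intro j hj
    simp only [Finset.mem_map, touching, Finset.mem_filter, Finset.mem_univ, true_and]
    exact ⟨⟨s(i, j), by simpa using (Finset.ne_of_mem_erase hj).symm⟩, ⟨i, by simp, by simp⟩, rfl⟩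
  · intro j _ k _ hjk
    exact Sym2.congr_right.1 hjk
  · intro e he
    simp only [Finset.mem_map, touching, Finset.mem_filter, Finset.mem_univ, true_and,
      Finset.mem_singleton, exists_eq_left] at he
    obtain ⟨e, hie, rfl⟩ := he
    obtain ⟨j, hj⟩ := hie
    refine ⟨j, ?_, hj.symm⟩
    have := e.2
    rw [hj] at this
    simpa [eq_comm] using this

/-- Inclusion–exclusion: the two stars share only {i, j}. This one shared pair causes the whole
correlation between isolation events, the factor 1/(1 - p₁₁) in the second moment. -/
theorem le_card_touching_pair {i j : Fin n} (hij : i ≠ j) :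
    2 * (n - 1) ≤ (touching {i, j}).card + 1 := by
  classical
  have h1 : touching {i, j} = touching {i} ∪ touching {j} := by
    ext e
    simp [touching]
  have h2 : (touching {i} ∩ touching {j}).card ≤ 1 := by
    rw [Finset.card_le_one]
    intro e he f hf
    simp only [touching, Finset.mem_inter, Finset.mem_filter, Finset.mem_univ, true_and,
      Finset.mem_singleton, exists_eq_left] at he hf
    exact Subtype.ext (((Sym2.mem_and_mem_iff hij).1 he).trans
      ((Sym2.mem_and_mem_iff hij).1 hf).symm)
  have h3 := Finset.card_union_add_card_inter (touching {i}) (touching {j})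
  rw [card_touching_singleton, card_touching_singleton] at h3
  rw [h1]
  omega

-- All vertices of S are isolated exactly when no pair touching S is a common edge, an event of
-- independent pairs.
open Classical in
theorem sum_weight_mul_isolated (p : EdgeProbs) (S : Finset (Fin n)) :
    ∑ a : VertexPair n → Bool, ∑ b : VertexPair n → Bool,
      weight p a b * (if S ⊆ isolated a b then 1 else 0) = (1 - p.p11) ^ (touching S).card := by
  have h := sum_sum_weight_mul_prod p (fun (e : VertexPair n) x y =>
    if e ∈ touching S then (if x = true ∧ y = true then 0 else 1) else 1)
  have hprod : ∀ a b : VertexPair n → Bool, (∏ e : VertexPair n,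
      if e ∈ touching S then (if a e = true ∧ b e = true then (0 : ℝ) else 1) else 1) =
      if S ⊆ isolated a b then 1 else 0 := by
    intro a b
    split_ifs with hS
    · refine Finset.prod_eq_one fun e _ => ?_
      split_ifs with he hab
      · simp only [touching, Finset.mem_filter, Finset.mem_univ, true_and] at he
        obtain ⟨i, hi, hie⟩ := he
        exact absurd hab (mem_isolated.1 (hS hi) e hie)
      · rfl
      · rfl
    · rw [Finset.not_subset] at hS
      obtain ⟨i, hi, hS⟩ := hS
      rw [mem_isolated] at hS
      push Not at hS
      obtain ⟨e, hie, hab⟩ := hS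
      refine Finset.prod_eq_zero (Finset.mem_univ e) ?_
      rw [if_pos, if_pos hab]
      simp only [touching, Finset.mem_filter, Finset.mem_univ, true_and]
      exact ⟨i, hi, hie⟩
  simp only [hprod] at h
  rw [h]
  have hsum := p.sum_eq_one
  have hfac : ∀ e : VertexPair n, ∑ x : Bool, ∑ y : Bool, p.prob (x, y) *
      (if e ∈ touching S then (if x = true ∧ y = true then (0 : ℝ) else 1) else 1) =
      if e ∈ touching S then 1 - p.p11 else 1 := by
    intro e
    simp only [Fintype.sum_bool, EdgeProbs.prob]
    by_cases he : e ∈ touching S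
    · simp [he]
      linarith
    · simp [he]
      linarith
  simp only [hfac]
  rw [← Finset.prod_filter, Finset.filter_univ_mem, Finset.prod_const]

/-- Chebyshev's inequality for the number of isolated vertices. -/
theorem eventProb_card_isolated_lt_le (p : EdgeProbs) (hn : 1 ≤ n) (hp : p.p11 < 1) :
    eventProb p (fun a b : VertexPair n → Bool => ((isolated a b).card : ℝ) <
      n * (1 - p.p11) ^ (n - 1) / 2) ≤
      4 / (n * (1 - p.p11) ^ (n - 1)) + 4 * (1 / (1 - p.p11) - 1) := by
  classical
  set r := 1 - p.p11 with hr
  have hr0 : 0 < r := by linarith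
  have hr1 : r ≤ 1 := by have := p.p11_nonneg; linarith
  have hn0 : (0 : ℝ) < n := by exact_mod_cast hn
  set μ := n * r ^ (n - 1) with hμ
  have hμ0 : 0 < μ := by positivity
  have hcard : ∀ a b : VertexPair n → Bool, ((isolated a b).card : ℝ) =
      ∑ i : Fin n, if ({i} : Finset (Fin n)) ⊆ isolated a b then 1 else 0 := by
    intro a b
    simp [Finset.singleton_subset_iff]
  have hcard2 : ∀ a b : VertexPair n → Bool, ((isolated a b).card : ℝ) ^ 2 =
      ∑ i : Fin n, ∑ j : Fin n, if ({i, j} : Finset (Fin n)) ⊆ isolated a b then 1 else 0 := by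
    intro a b
    rw [pow_two, hcard, Finset.sum_mul_sum]
    refine Finset.sum_congr rfl fun i _ => Finset.sum_congr rfl fun j _ => ?_
    simp only [Finset.singleton_subset_iff, Finset.insert_subset_iff]
    by_cases h1 : i ∈ isolated a b <;> by_cases h2 : j ∈ isolated a b <;> simp [h1, h2]
  have hE1 : ∑ a : VertexPair n → Bool, ∑ b : VertexPair n → Bool,
      weight p a b * ((isolated a b).card : ℝ) = μ := by
    simp only [hcard, Finset.mul_sum]
    rw [Finset.sum_congr rfl fun a _ => Finset.sum_comm, Finset.sum_comm]
    simp only [sum_weight_mul_isolated, card_touching_singleton]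
    rw [Finset.sum_const, Finset.card_univ, Fintype.card_fin, nsmul_eq_mul]
  have hE2 : ∑ a : VertexPair n → Bool, ∑ b : VertexPair n → Bool,
      weight p a b * ((isolated a b).card : ℝ) ^ 2 ≤ μ + μ ^ 2 / r := by
    simp only [hcard2, Finset.mul_sum]
    rw [Finset.sum_congr rfl fun a _ => Finset.sum_comm, Finset.sum_comm]
    rw [Finset.sum_congr rfl fun i _ => Finset.sum_congr rfl fun a _ => Finset.sum_comm,
      Finset.sum_congr rfl fun i _ => Finset.sum_comm]
    simp only [sum_weight_mul_isolated]
    calc ∑ i : Fin n, ∑ j : Fin n, r ^ (touching {i, j}).card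
        ≤ ∑ i : Fin n, ∑ j : Fin n,
          ((if i = j then r ^ (n - 1) else 0) + (r ^ (n - 1)) ^ 2 / r) := by
          refine Finset.sum_le_sum fun i _ => Finset.sum_le_sum fun j _ => ?_
          by_cases hij : i = j
          · subst hij
            rw [Finset.pair_eq_singleton, card_touching_singleton, if_pos rfl]
            have : 0 ≤ (r ^ (n - 1)) ^ 2 / r := by positivity
            linarith
          · rw [if_neg hij, zero_add, le_div_iff₀ hr0, ← pow_succ, ← pow_mul]
            refine pow_le_pow_of_le_one hr0.le hr1 ?_
            rw [mul_comm]
            exact le_card_touching_pair hij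
      _ = _ := by
          simp only [Finset.sum_add_distrib, Finset.sum_ite_eq, Finset.mem_univ, if_true,
            Finset.sum_const, Finset.card_univ, Fintype.card_fin, nsmul_eq_mul]
          rw [hμ]
          ring
  refine (eventProb_le_of_one_le p
    (g := fun a b => (4 / μ ^ 2) * (((isolated a b).card : ℝ) - μ) ^ 2)
    (fun a b => by positivity) ?_).trans ?_
  · intro a b hab
    have : (μ / 2) ^ 2 ≤ (((isolated a b).card : ℝ) - μ) ^ 2 := by
      rw [← neg_sq (((isolated a b).card : ℝ) - μ)]
      exact pow_le_pow_left₀ (by positivity) (by linarith) 2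
    calc (1 : ℝ) = 4 / μ ^ 2 * (μ / 2) ^ 2 := by field_simp; norm_num
      _ ≤ _ := by gcongr
  · have hexp : ∑ a : VertexPair n → Bool, ∑ b : VertexPair n → Bool,
        weight p a b * ((4 / μ ^ 2) * (((isolated a b).card : ℝ) - μ) ^ 2) =
        (4 / μ ^ 2) * (∑ a : VertexPair n → Bool, ∑ b : VertexPair n → Bool,
          weight p a b * ((isolated a b).card : ℝ) ^ 2 - 2 * μ *
          ∑ a : VertexPair n → Bool, ∑ b : VertexPair n → Bool,
            weight p a b * ((isolated a b).card : ℝ) +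
          μ ^ 2 * ∑ a : VertexPair n → Bool, ∑ b : VertexPair n → Bool, weight p a b) := by
      simp only [Finset.mul_sum, ← Finset.sum_add_distrib, ← Finset.sum_sub_distrib]
      refine Finset.sum_congr rfl fun a _ => Finset.sum_congr rfl fun b _ => ?_
      ring
    rw [hexp, hE1, sum_sum_weight]
    calc _ ≤ (4 / μ ^ 2) * (μ + μ ^ 2 / r - 2 * μ * μ + μ ^ 2 * 1) := by gcongr
      _ = _ := by
        field_simp
        ring

/-- For 0 ≤ q ≤ 1/2, 1 - q ≥ exp(-q - 2q²), because (1 - q)(1 + q + 2q²) = 1 + q²(1 - 2q) ≥ 1. The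
quadratic term costs 2nq² ≤ 2(log n)²/n. -/
theorem exp_le_mul_one_sub_pow {n : ℕ} (hn : 1 ≤ n) {q w : ℝ} (hq0 : 0 ≤ q) (hq : q ≤ 1 / 2)
    (hw : 0 ≤ w) (hqn : q * n ≤ Real.log n - w) :
    Real.exp (w - 2 * (Real.log n ^ 2 / n)) ≤ n * (1 - q) ^ (n - 1) := by
  have hn0 : (0 : ℝ) < n := by exact_mod_cast hn
  have hr0 : 0 < 1 - q := by linarith
  have h1 : Real.exp (-(q + 2 * q ^ 2)) ≤ 1 - q := by
    have h := Real.add_one_le_exp (q + 2 * q ^ 2)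
    rw [Real.exp_neg, inv_le_comm₀ (Real.exp_pos _) hr0]
    refine le_trans ?_ h
    rw [inv_le_iff_one_le_mul₀ hr0]
    nlinarith [mul_nonneg (sq_nonneg q) (show 0 ≤ 1 - 2 * q by linarith)]
  have h2 : (q * n) ^ 2 ≤ Real.log n ^ 2 :=
    pow_le_pow_left₀ (by positivity) (by linarith) 2
  calc Real.exp (w - 2 * (Real.log n ^ 2 / n))
      ≤ Real.exp (Real.log n + n * (-(q + 2 * q ^ 2))) := by
        refine Real.exp_le_exp.2 ?_
        have : n * q ^ 2 ≤ Real.log n ^ 2 / n := by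
          rw [le_div_iff₀ hn0]
          linarith
        linarith
    _ = n * Real.exp (-(q + 2 * q ^ 2)) ^ n := by
        rw [Real.exp_add, Real.exp_log hn0, Real.exp_nat_mul]
    _ ≤ n * (1 - q) ^ n := by gcongr
    _ ≤ n * (1 - q) ^ (n - 1) := by
        refine mul_le_mul_of_nonneg_left ?_ hn0.le
        exact pow_le_pow_of_le_one hr0.le (by linarith) (Nat.sub_le _ _)

theorem converse (p : ℕ → EdgeProbs) (w : ℕ → ℝ) (hw : Tendsto w atTop atTop)
    (h0 : ∀ᶠ n : ℕ in atTop, (p n).p11 ≤ (Real.log n - w n) / n)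
    (h1 : ∀ᶠ n : ℕ in atTop, (p n).p01 * (p n).p10 < (p n).p11 * (p n).p00)
    (est : (n : ℕ) → Estimator n) :
    Tendsto (fun n => successProb (p n) (est n)) atTop (𝓝 0) := by
  have hlogsq : Tendsto (fun n : ℕ => Real.log n ^ 2 / n) atTop (𝓝 0) :=
    (Real.isLittleO_pow_log_id_atTop (n := 2)).tendsto_div_nhds_zero.comp tendsto_natCast_atTop_atTop
  have hlog : Tendsto (fun n : ℕ => Real.log n / n) atTop (𝓝 0) :=
    Real.isLittleO_log_id_atTop.tendsto_div_nhds_zero.comp tendsto_natCast_atTop_atTop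
  have hp0 : Tendsto (fun n => (p n).p11) atTop (𝓝 0) := by
    refine tendsto_of_tendsto_of_tendsto_of_le_of_le' tendsto_const_nhds hlog
      (Eventually.of_forall fun n => (p n).p11_nonneg) ?_
    filter_upwards [h0, hw.eventually_ge_atTop 0] with n e0 ew
    refine e0.trans (div_le_div_of_nonneg_right (by linarith) (Nat.cast_nonneg n))
  have hμ : Tendsto (fun n : ℕ => n * (1 - (p n).p11) ^ (n - 1)) atTop atTop := by
    have hexp : Tendsto (fun n : ℕ => Real.exp (w n - 2 * (Real.log n ^ 2 / n))) atTop atTop := by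
      refine Real.tendsto_exp_atTop.comp ?_
      simp only [sub_eq_add_neg]
      exact hw.atTop_add (hlogsq.const_mul 2).neg
    refine tendsto_atTop_mono' _ ?_ hexp
    filter_upwards [h0, hw.eventually_ge_atTop 0, eventually_ge_atTop 1,
      hp0.eventually_le_const (show (0 : ℝ) < 1 / 2 by norm_num)] with n e0 ew en ep
    have hn0 : (0 : ℝ) < n := by exact_mod_cast en
    exact exp_le_mul_one_sub_pow en (p n).p11_nonneg ep ew ((le_div_iff₀ hn0).1 e0)
  have hlim : Tendsto (fun n : ℕ => 6 / (n * (1 - (p n).p11) ^ (n - 1)) +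
      4 * (1 / (1 - (p n).p11) - 1)) atTop (𝓝 0) := by
    have hinv : Tendsto (fun n => 1 / (1 - (p n).p11)) atTop (𝓝 (1 / (1 - 0))) :=
      tendsto_const_nhds.div (hp0.const_sub 1) (by norm_num)
    have := (hμ.const_div_atTop 6).add ((hinv.sub_const 1).const_mul 4)
    simpa using this
  refine tendsto_of_tendsto_of_tendsto_of_le_of_le' tendsto_const_nhds hlim
    (Eventually.of_forall fun n => ENNReal.toReal_nonneg) ?_
  filter_upwards [h1, eventually_ge_atTop 1,
    hp0.eventually_le_const (show (0 : ℝ) < 1 / 2 by norm_num)] with n e1 en ep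
  have hn0 : (0 : ℝ) < n := by exact_mod_cast en
  have hr0 : 0 < 1 - (p n).p11 := by linarith
  have hμ0 : 0 < n * (1 - (p n).p11) ^ (n - 1) := by positivity
  refine (successProb_le (p n) e1.le (est n) (half_pos hμ0)).trans ?_
  have := eventProb_card_isolated_lt_le (p n) en (by linarith)
  -- With μ the mean, the threshold M = μ/2 contributes 2/μ and Chebyshev 4/μ.
  have h6 : 1 / (n * (1 - (p n).p11) ^ (n - 1) / 2) + 4 / (n * (1 - (p n).p11) ^ (n - 1)) =
      6 / (n * (1 - (p n).p11) ^ (n - 1)) := by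
    field_simp
    norm_num
  linarith

end Converse

end GraphAlignment

theorem theorem1 :
    -- achievability
    (∀ (p : ℕ → GraphAlignment.EdgeProbs) (w : ℕ → ℝ),
      Tendsto w atTop atTop →
      (∀ᶠ n : ℕ in atTop, (Real.log n + w n) / n ≤ (p n).p11) →
      ((fun n : ℕ => (p n).p11) =O[atTop] fun n : ℕ => 1 / Real.log n) →
      ((fun n : ℕ => (p n).p01 + (p n).p10) =O[atTop] fun n : ℕ => 1 / Real.log n) →
      ((fun n : ℕ => ((p n).p01 * (p n).p10) / ((p n).p11 * (p n).p00)) =O[atTop]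
        fun n : ℕ => 1 / (Real.log n) ^ 3) →
      ∃ est : (n : ℕ) → GraphAlignment.Estimator n,
        Tendsto (fun n => GraphAlignment.successProb (p n) (est n)) atTop (𝓝 1)) ∧
    -- converse
    (∀ (p : ℕ → GraphAlignment.EdgeProbs) (w : ℕ → ℝ),
      Tendsto w atTop atTop →
      (∀ᶠ n : ℕ in atTop, (p n).p11 ≤ (Real.log n - w n) / n) →
      (∀ᶠ n : ℕ in atTop, (p n).p01 * (p n).p10 < (p n).p11 * (p n).p00) →
      ∀ est : (n : ℕ) → GraphAlignment.Estimator n,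
        Tendsto (fun n => GraphAlignment.successProb (p n) (est n)) atTop (𝓝 0)) :=
  ⟨fun p w hw h0 h1 h2 h3 => GraphAlignment.achievability p w hw h0 h1 h2 h3,
    fun p w hw h0 h1 est => GraphAlignment.converse p w hw h0 h1 est⟩
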